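/- Let $\mathcal C$ be a small category, $\mathcal M$ a model category with all small colimits and $\gamma\colon \mathcal C\to\mathcal M$ a functor. Let $U\mathcal C=s\mathcal{S}et^{\mathcal C^{op}}$ be the category of simplicial presheaves on $\mathcal C$ with the Bousfield–Kan (projective) model structure: weak equivalences and fibrations are the maps that are objectwise weak equivalences, resp. fibrations, for the Kan–Quillen model structure on simplicial sets, and cofibrations have the left lifting property against the trivial fibrations. Let $r\colon\mathcal C\to U\mathcal C$ be the Yoneda embedding, with presheaves of sets regarded as discrete simplicial presheaves. Let $\mathrm{Fact}_{\mathcal M}(\gamma)$ be the category of triples $(L,R,\eta)$, where $L\colon U\mathcal C\rightleftarrows\mathcal M\colon R$ is a Quillen pair and $\eta\colon L\circ r\to\gamma$ is a natural weak equivalence; a map $(L,R,\eta)\to(L',R',\eta')$ is a natural transformation $\alpha\colon L\to L'$ with $\eta'_X\circ\alpha_{rX}=\eta_X$ for all $X$. Let $\mathrm{coRes}(\gamma)$ be the category of cosimplicial resolutions of $\gamma$: functors $\Gamma\colon\mathcal C\to c\mathcal M$ to cosimplicial objects of $\mathcal M$ such that every $\Gamma(X)$ is Reedy cofibrant, together with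 a natural map $\Gamma(X)\to c^*\gamma(X)$ to the constant cosimplicial object which is a weak equivalence in every degree; maps are natural transformations $\Gamma_1\to\Gamma_2$ commuting with the maps to $c^*\gamma$. Then there is an equivalence of categories $$\mathrm{Fact}_{\mathcal M}(\gamma)\simeq\mathrm{coRes}(\gamma)$$ that is given, up to natural isomorphism, as follows. (1) It sends $(L,R,\eta)$ to $\Gamma(X)=\bigl([n]\mapsto L(rX\otimes\Delta^n)\bigr)$, with the map $L(rX\otimes\Delta^n)\to L(rX)\xrightarrow{\eta_X}\gamma(X)$ induced by the projection $rX\otimes\Delta^n=rX\times\Delta^n\to rX$. (2) Its inverse sends $\Gamma$ to $L(F)=\Gamma\otimes_{\mathcal C}F$, the coend over $\mathcal C$ of $(b,a)\mapsto\Gamma(a)\otimes F(b)$, where for a cosimplicial object $A$ and a simplicial set $K$ one writes $A\otimes K$ for the coend over $\Delta$ of the copowers $A_k\cdot K_m$; to $R(W)=\mathcal M(\Gamma,W)$, the simplicial presheaf $c\mapsto\bigl([n]\mapsto\mathcal M(\Gamma(c)_n,W)\bigr)$; with the adjunction under which $f\colon\Gamma\otimes_{\mathcal C}F\to W$ corresponds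 to the map that sends $x\in F(c)_n$ to the composite of $f$ with the canonical map $\Gamma(c)_n\to\Gamma\otimes_{\mathcal C}F$ attached to $x$; and with the $\eta_X$ that is the composite $\Gamma\otimes_{\mathcal C}rX\cong\Gamma(X)_0\to\gamma(X)$, where the canonical map $\Gamma(X)_0\to\Gamma\otimes_{\mathcal C}rX$ attached to $\mathrm{id}_X\in (rX)(X)_0$ is an isomorphism and $\Gamma(X)_0\to\gamma(X)$ is the degree $0$ part of the map of the resolution. -/

import Mathlib

open CategoryTheory Limits HomotopicalAlgebra Opposite MonoidalCategory Simplicial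

universe u w

namespace UniversalModelCategory

noncomputable section

section ModelStructure

open SSet.modelCategoryQuillen

/-- The weak equivalences of the Kan-Quillen model structure on simplicial sets. As in every model
category, they are determined by the cofibrations (here: the monomorphisms) and the fibrations
(here: the Kan fibrations): a weak equivalence is a map that factors as a trivial cofibration,
i.e. a map with the left lifting property against the fibrations (an anodyne extension), followed
by a trivial fibration, i.e. a map with the right lifting property against the cofibrations. -/
def sSetWeakEquivalences : MorphismProperty SSet.{u} :=
  fun X Y f ↦ ∃ (Z : SSet.{u}) (i : X ⟶ Z) (p : Z ⟶ Y),
    (fibrations SSet.{u}).llp i ∧ (cofibrations SSet.{u}).rlp p ∧ i ≫ p = f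

/-- The category `U𝒞` of simplicial presheaves on `𝒞`. -/
abbrev U (C : Type u) [Category.{u} C] := Cᵒᵖ ⥤ SSet.{u}

variable (C : Type u) [Category.{u} C]

/-- Weak equivalences of simplicial presheaves are the objectwise weak equivalences. -/
instance : CategoryWithWeakEquivalences (U C) where
  weakEquivalences := fun _ _ f ↦ ∀ X, sSetWeakEquivalences (f.app X)

/-- Fibrations of simplicial presheaves are the objectwise Kan fibrations. -/
instance : CategoryWithFibrations (U C) where
  fibrations := fun _ _ f ↦ ∀ X, fibrations SSet.{u} (f.app X)

/-- Cofibrations of simplicial presheaves have the left lifting property against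
the trivial fibrations. -/
instance : CategoryWithCofibrations (U C) where
  cofibrations := (trivialFibrations (U C)).llp

end ModelStructure

/-- An adjoint pair is a Quillen pair if the right adjoint preserves fibrations and
trivial fibrations. -/
structure IsQuillenPair {A : Type*} [Category* A] {B : Type*} [Category* B]
    [CategoryWithFibrations A] [CategoryWithWeakEquivalences A]
    [CategoryWithFibrations B] [CategoryWithWeakEquivalences B]
    {L : A ⥤ B} {R : B ⥤ A} (_ : L ⊣ R) : Prop where
  map_fibration : ∀ ⦃X Y : B⦄ (f : X ⟶ Y), fibrations B f → fibrations A (R.map f)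
  map_trivialFibration : ∀ ⦃X Y : B⦄ (f : X ⟶ Y),
    trivialFibrations B f → trivialFibrations A (R.map f)

section Representables

variable (C : Type u) [Category.{u} C]

/-- The embedding `r : 𝒞 ⥤ U𝒞`: Yoneda, followed by the inclusion of presheaves as discrete
simplicial presheaves. -/
def r : C ⥤ U C :=
  yoneda ⋙ (Functor.whiskeringRight Cᵒᵖ (Type u) SSet.{u}).obj (SimplicialObject.const (Type u))

/-- The functor `X ↦ ([n] ↦ rX ⊗ Δ[n])` where `rX ⊗ Δ[n]` is the product of `rX` with the constant
simplicial presheaf at the standard simplex. -/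
def rTensorSimplex : C ⥤ CosimplicialObject (U C) :=
  r C ⋙ curriedTensor (U C) ⋙
    (Functor.whiskeringLeft SimplexCategory (U C) (U C)).obj
      (SSet.stdSimplex.{u} ⋙ Functor.const Cᵒᵖ)

/-- The projection `rX ⊗ Δ[n] ⟶ rX`. -/
def rTensorSimplexProj (X : C) (n : SimplexCategory) :
    ((rTensorSimplex C).obj X).obj n ⟶ (r C).obj X :=
  CartesianMonoidalCategory.fst ((r C).obj X)
    ((Functor.const Cᵒᵖ).obj (SSet.stdSimplex.{u}.obj n))

end Representables

section Factorizations

variable {C : Type u} [Category.{u} C] {M : Type w} [Category.{u} M] [ModelCategory M]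

/-- A factorization `(L, R, η)` of `γ : 𝒞 ⥤ ℳ` through `U𝒞`: a Quillen pair `L ⊣ R` with a natural
weak equivalence `η : L ∘ r ⟶ γ`. -/
structure Factorization (γ : C ⥤ M) where
  L : U C ⥤ M
  R : M ⥤ U C
  adj : L ⊣ R
  isQuillenPair : IsQuillenPair adj
  η : r C ⋙ L ⟶ γ
  weakEquivalence_η : ∀ X, WeakEquivalence (η.app X)

variable {γ : C ⥤ M}

/-- A map of factorizations is a natural transformation `L ⟶ L'` over `γ`. -/
@[ext]
structure Factorization.Hom (P Q : Factorization γ) where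
  hom : P.L ⟶ Q.L
  w : ∀ X, hom.app ((r C).obj X) ≫ Q.η.app X = P.η.app X

instance : Category (Factorization γ) where
  Hom := Factorization.Hom
  id P := { hom := 𝟙 P.L, w := by simp }
  comp f g := { hom := f.hom ≫ g.hom, w := by simp [f.w, g.w] }
  id_comp f := Factorization.Hom.ext (Category.id_comp f.hom)
  comp_id f := Factorization.Hom.ext (Category.comp_id f.hom)
  assoc f g h := Factorization.Hom.ext (Category.assoc f.hom g.hom h.hom)

variable (γ) in
/-- The functor `(L, R, η) ↦ L`. -/
def Factorization.left : Factorization γ ⥤ U C ⥤ M where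
  obj P := P.L
  map f := Factorization.Hom.hom f

variable (γ) in
/-- The functor `(L, R, η) ↦ (X ↦ ([n] ↦ L(rX ⊗ Δ[n])))`. -/
def Factorization.cosimplicial : Factorization γ ⥤ C ⥤ CosimplicialObject M :=
  Factorization.left γ ⋙ Functor.whiskeringRight SimplexCategory (U C) M ⋙
    (Functor.whiskeringLeft C (CosimplicialObject (U C)) (CosimplicialObject M)).obj
      (rTensorSimplex C)

end Factorizations

section Resolutions

/-- The latching category at `[n]`: the non-identity injections `[k] ⟶ [n]` and the maps over `[n]`
between them (which are automatically injective). -/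
abbrev LatchingCategory (n : SimplexCategory) :=
  ObjectProperty.FullSubcategory (fun f : Over n ↦ Mono f.hom ∧ ¬ IsIso f.hom)

variable {M : Type w} [Category.{u} M] [HasColimits M]

/-- The restriction of a cosimplicial object to the latching category at `[n]`. -/
abbrev latchingDiagram (A : CosimplicialObject M) (n : SimplexCategory) : LatchingCategory n ⥤ M :=
  ObjectProperty.ι _ ⋙ Over.forget n ⋙ A

/-- The latching object of a cosimplicial object. -/
def latchingObj (A : CosimplicialObject M) (n : SimplexCategory) : M :=
  colimit (latchingDiagram A n)

/-- The latching map of a cosimplicial object. -/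
def latchingMap (A : CosimplicialObject M) (n : SimplexCategory) : latchingObj A n ⟶ A.obj n :=
  colimit.desc (latchingDiagram A n)
    { pt := A.obj n
      ι :=
        { app := fun f ↦ A.map f.obj.hom
          naturality := fun f g φ ↦ by
            have h : φ.hom.left ≫ g.obj.hom = f.obj.hom := Over.w φ.hom
            change A.map φ.hom.left ≫ A.map g.obj.hom = A.map f.obj.hom ≫ 𝟙 _
            rw [← A.map_comp, h, Category.comp_id] } }

/-- A cosimplicial object is Reedy cofibrant if all its latching maps are cofibrations. -/
def IsReedyCofibrant [CategoryWithCofibrations M] (A : CosimplicialObject M) : Prop :=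
  ∀ n, Cofibration (latchingMap A n)

variable {C : Type u} [Category.{u} C] [ModelCategory M]

/-- A cosimplicial resolution of `γ : 𝒞 ⥤ ℳ`: a functor `Γ` to cosimplicial objects with Reedy
cofibrant values, with a natural map from `Γ(X)` to the constant cosimplicial object on `γ(X)` that
is a weak equivalence in every degree. -/
structure CoRes (γ : C ⥤ M) where
  Γ : C ⥤ CosimplicialObject M
  isReedyCofibrant : ∀ X, IsReedyCofibrant (Γ.obj X)
  aug : Γ ⟶ γ ⋙ CosimplicialObject.const M
  weakEquivalence_aug : ∀ X n, WeakEquivalence ((aug.app X).app n)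

variable {γ : C ⥤ M}

/-- A map of cosimplicial resolutions is a natural transformation over the constant objects. -/
@[ext]
structure CoRes.Hom (P Q : CoRes γ) where
  hom : P.Γ ⟶ Q.Γ
  w : hom ≫ Q.aug = P.aug

instance : Category (CoRes γ) where
  Hom := CoRes.Hom
  id P := { hom := 𝟙 P.Γ, w := by simp }
  comp f g := { hom := f.hom ≫ g.hom, w := by simp [f.w, g.w] }
  id_comp f := CoRes.Hom.ext (Category.id_comp f.hom)
  comp_id f := CoRes.Hom.ext (Category.comp_id f.hom)
  assoc f g h := CoRes.Hom.ext (Category.assoc f.hom g.hom h.hom)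

variable (γ) in
/-- The functor that forgets the augmentation of a cosimplicial resolution. -/
def CoRes.forget : CoRes γ ⥤ C ⥤ CosimplicialObject M where
  obj P := P.Γ
  map f := CoRes.Hom.hom f

end Resolutions

section Coends

/-- For a bifunctor `T : A ⥤ B ⥤ M`, the coend of `(b, a) ↦ T(G a, F b)` over `J`, as a functor of
`G : J ⥤ A` and `F : Jᵒᵖ ⥤ B`. -/
def coendBifunctor (J : Type*) [Category* J] {A : Type*} [Category* A] {B : Type*} [Category* B]
    {M : Type*} [Category* M] [∀ (H : Jᵒᵖ ⥤ J ⥤ M), HasCoend H] (T : A ⥤ B ⥤ M) :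
    (J ⥤ A) ⥤ (Jᵒᵖ ⥤ B) ⥤ M :=
  Functor.whiskeringLeft J A M ⋙ (Functor.whiskeringLeft B (A ⥤ M) (J ⥤ M)).obj T.flip ⋙
    Functor.whiskeringRight Jᵒᵖ B (J ⥤ M) ⋙
      (Functor.whiskeringRight (Jᵒᵖ ⥤ B) (Jᵒᵖ ⥤ J ⥤ M) M).obj (coendFunctor J M)

variable {M : Type w} [Category.{u} M] [HasColimits M]

variable (M) in
/-- The tensor product `X ⊗ K` of a cosimplicial object with a simplicial set: the coend over the
simplex category of the copowers `X_k · K_m`. -/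
def tensorSSet : CosimplicialObject M ⥤ SSet.{u} ⥤ M :=
  coendBifunctor SimplexCategory (sigmaConst.{u} (C := M))

variable (C : Type u) [Category.{u} C]

variable (M) in
/-- The coend `Γ ⊗_𝒞 F` of `(b, a) ↦ Γ(a) ⊗ F(b)`, as a functor of `Γ` and `F`. -/
def tensorU : (C ⥤ CosimplicialObject M) ⥤ U C ⥤ M :=
  coendBifunctor C (tensorSSet M)

variable {C}

/-- The canonical map `Γ(c)_n ⟶ Γ ⊗_𝒞 F` attached to an `n`-simplex `x` of `F(c)`. -/
def tensorUι (Γ : C ⥤ CosimplicialObject M) (F : U C) (c : C) (n : SimplexCategory)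
    (x : (F.obj (op c)).obj (op n)) :
    (Γ.obj c).obj n ⟶ ((tensorU M C).obj Γ).obj F :=
  Sigma.ι (fun _ : (F.obj (op c)).obj (op n) ↦ (Γ.obj c).obj n) x ≫
    coend.ι (F.obj (op c) ⋙ (sigmaConst.{u} (C := M)).flip ⋙
      (Functor.whiskeringLeft SimplexCategory M M).obj (Γ.obj c)) n ≫
    coend.ι (F ⋙ (tensorSSet M).flip ⋙
      (Functor.whiskeringLeft C (CosimplicialObject M) M).obj Γ) c

/-- The functor `W ↦ ℳ(Γ, W)`, where `ℳ(Γ, W)` is the simplicial presheaf with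
`ℳ(Γ, W)(c)_n = ℳ(Γ(c)_n, W)`. -/
def sing (Γ : C ⥤ CosimplicialObject M) : M ⥤ U C where
  obj W :=
    { obj := fun c ↦ (Γ.obj c.unop).op ⋙ yoneda.obj W
      map := fun f ↦ Functor.whiskerRight (NatTrans.op (Γ.map f.unop)) (yoneda.obj W)
      map_id := fun c ↦ by
        rw [unop_id, Γ.map_id]
        exact Functor.whiskerRight_id' _
      map_comp := fun f g ↦ by
        rw [unop_comp, Γ.map_comp]
        exact Functor.whiskerRight_comp (NatTrans.op (Γ.map f.unop)) (NatTrans.op (Γ.map g.unop)) _ }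
  map g := { app := fun c ↦ Functor.whiskerLeft (Γ.obj c.unop).op (yoneda.map g) }

end Coends

end

end UniversalModelCategory

/-! A simplicial presheaf is governed by its simplices: by Yoneda, F(X)_n is the set of maps rX ⊗
Δ[n] ⟶ F (`rTensorSimplexEquiv`). For an adjunction L ⊣ R this gives R(W)(X)_n = ℳ(Γ(X)_n, W) with
Γ(X)_n = L(rX ⊗ Δ[n]), so Γ determines R (`Factorization.singIso`) and hence L, which must be the
coend Γ ⊗_𝒞 -. Conversely, any Γ is recovered from its coend functor, since Γ ⊗_𝒞 (rX ⊗ Δ[n]) ≅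
Γ(X)_n. This is the categorical half of the equivalence.

The homotopical half matches the Quillen condition with the resolution condition. Since fibrations
and trivial fibrations of presheaves are objectwise, only the functors ℳ(A, -) with A = Γ(X) matter.
The tensors of A with the boundary inclusions are the latching maps, so preservation of trivial
fibrations is Reedy cofibrancy (`isReedyCofibrant_iff`).

For fibrations, let A be Reedy cofibrant with weak equivalences A_0 ⟶ A_n. The maps f for which A ⊗
f is a trivial cofibration contain the vertices of simplices, and a purely combinatorial induction
(`horn_ι_mem`) shows that they then contain the horns (`fibrations_singSSet_map`). In the other
direction the first vertex of Δ[n] is anodyne, so preservation of fibrations makes some map A_0 ⟶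
A_n a trivial cofibration; two-out-of-three then makes the augmentation a weak equivalence in degree
n. -/

namespace UniversalModelCategory

noncomputable section

/-! ### Simplicial sets: trivial fibrations, vertices and horns. -/

section SimplicialSets

open SSet SSet.modelCategoryQuillen

/-- A Kan fibration is a weak equivalence if and only if it has the right lifting property against
all monomorphisms. -/
lemma fibrations_and_sSetWeakEquivalences_iff {X Y : SSet.{u}} (f : X ⟶ Y) :
    (fibrations SSet.{u} f ∧ sSetWeakEquivalences f) ↔ (cofibrations SSet.{u}).rlp f := by
  constructor
  · rintro ⟨hf, Z, i, p, hi, hp, fac⟩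
    -- Retract argument: `i` lifts against `f`, and the lift exhibits `f` as a retract of `p`.
    have := hi f hf
    have sq : CommSq (𝟙 X) i f p := ⟨by simp [fac]⟩
    exact MorphismProperty.of_retract (P := (cofibrations SSet.{u}).rlp)
      (f := f) (g := p)
      { i := Arrow.homMk i (𝟙 Y) (by simp [fac])
        r := Arrow.homMk sq.lift (𝟙 Y) (by simp) } hp
  · intro hf
    refine ⟨fun _ _ j hj ↦ hf j (J_le_monomorphisms j hj), X, 𝟙 X, f, ?_, hf, by simp⟩
    intro _ _ p _
    infer_instance

/-- The only face in this horn is the one opposite to the vertex 1. This makes the vertex 0 of Δ[1]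
anodyne, as needed for the pushout-product below. -/
lemma horn_one_zero_eq_face : Λ[1, 0] = SSet.stdSimplex.face.{u} {0} := by
  rw [horn_eq_iSup]
  apply le_antisymm
  · simp only [iSup_le_iff]
    rintro ⟨j, hj⟩
    rw [stdSimplex.face_le_face_iff]
    intro i hi
    simp at hi hj ⊢
    omega
  · refine le_trans ?_ (le_iSup _ ⟨1, by simp⟩)
    rw [stdSimplex.face_le_face_iff]
    simp

/-- The contraction of `Δ[n]` onto its first vertex. -/
def contraction (n : ℕ) : Δ[n] ⊗ Δ[1] ⟶ (Δ[n] : SSet.{u}) where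
  app m := ↾fun x ↦ SSet.stdSimplex.objMk
    { toFun := fun i ↦
        if SSet.stdSimplex.asOrderHom x.2 i = 0 then 0 else SSet.stdSimplex.asOrderHom x.1 i
      monotone' := fun i j hij ↦ by
        have h₁ := (SSet.stdSimplex.asOrderHom x.1).monotone hij
        have h₂ := (SSet.stdSimplex.asOrderHom x.2).monotone hij
        dsimp only
        split_ifs with h₃ h₄ h₄
        · exact le_rfl
        · exact Fin.zero_le _
        · rw [h₄] at h₂
          exact absurd (Fin.le_zero_iff.1 h₂) h₃
        · exact h₁ }
  naturality _ _ _ := rfl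

/-- The inclusion `Δ[n] ⟶ Δ[n] ⊗ Δ[1]` at the vertex `1`. -/
def inclOne (n : ℕ) : (Δ[n] : SSet.{u}) ⟶ Δ[n] ⊗ Δ[1] :=
  CartesianMonoidalCategory.lift (𝟙 _) (SSet.const (SSet.stdSimplex.obj₀Equiv.symm 1))

lemma inclOne_contraction (n : ℕ) : inclOne.{u} n ≫ contraction n = 𝟙 _ := by
  ext ⟨m⟩ x
  induction m using SimplexCategory.rec with | _ m
  apply SSet.stdSimplex.ext
  intro i
  rfl

/-- The pushout-product of this inclusion with {0} ⊂ Δ[1] is anodyne, and the inclusion is a retract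
of it: `inclOne` is the section and `contraction` the retraction. The contraction collapses both {0}
× Δ[1] and Δ[n] × {0} to the vertex 0. -/
lemma anodyneExtensions_face_zero_ι (n : ℕ) :
    anodyneExtensions (SSet.stdSimplex.face.{u} ({0} : Finset (Fin (n + 1)))).ι := by
  have h := anodyneExtensions_unionProd_ι (SSet.stdSimplex.face.{u} ({0} : Finset (Fin (n + 1))))
    (SSet.stdSimplex.face.{u} ({0} : Finset (Fin 2))) (by
      rw [← horn_one_zero_eq_face]
      exact anodyneExtensions.horn_ι 0)
  refine MorphismProperty.of_retract (P := anodyneExtensions) ?_ h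
  refine
    { i := Arrow.homMk (Subcomplex.lift (Subcomplex.ι _ ≫ inclOne n) ?_) (inclOne n) rfl
      r := Arrow.homMk (Subcomplex.lift (Subcomplex.ι _ ≫ contraction n) ?_) (contraction n) rfl
      retract := ?_ }
  · rintro m _ ⟨x, rfl⟩
    exact Or.inr ⟨x.2, trivial⟩
  · rintro ⟨m⟩ _ ⟨⟨⟨x, y⟩, h⟩, rfl⟩
    induction m using SimplexCategory.rec with | _ m
    refine (SSet.stdSimplex.mem_face_iff _ _).2 fun i ↦ ?_
    change (if y i = 0 then 0 else x i) ∈ _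
    obtain ⟨-, h⟩ | ⟨h, -⟩ := h
    · have := (SSet.stdSimplex.mem_face_iff _ _).1 h i
      rw [if_pos (by simpa using this)]
      simp
    · have := (SSet.stdSimplex.mem_face_iff _ _).1 h i
      split_ifs
      · simp
      · exact this
  · ext : 1
    · exact (cancel_mono (Subcomplex.ι _)).1 (by
        change _ = 𝟙 _ ≫ Subcomplex.ι _
        rw [Category.id_comp]
        change (Subcomplex.ι _ ≫ inclOne n) ≫ contraction n = _
        rw [Category.assoc, inclOne_contraction, Category.comp_id])
    · exact inclOne_contraction n

/-- The first vertex of `Δ[n]` is an anodyne extension. -/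
lemma exists_anodyneExtensions_stdSimplex_map (n : SimplexCategory) :
    ∃ φ : ⦋0⦌ ⟶ n, anodyneExtensions (SSet.stdSimplex.{u}.map φ) := by
  induction n using SimplexCategory.rec with | _ n
  let b := SSet.stdSimplex.faceSingletonIso.{u} (0 : Fin (n + 1))
  obtain ⟨φ, hφ⟩ := SSet.stdSimplex.{u}.map_surjective (b.hom ≫ Subcomplex.ι _)
  refine ⟨φ, (anodyneExtensions.arrow_mk_iso_iff (Arrow.isoMk b (Iso.refl _) ?_)).2
    (anodyneExtensions_face_zero_ι n)⟩
  change b.hom ≫ Subcomplex.ι _ = SSet.stdSimplex.map φ ≫ 𝟙 _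
  simp [hφ]

/-- The union of the vertex `k` of `Δ[n]` with the faces in a list. -/
def facesUnion {n : ℕ} (k : Fin (n + 1)) (l : List (Finset (Fin (n + 1)))) :
    (Δ[n] : SSet.{u}).Subcomplex :=
  l.foldr (fun S K ↦ SSet.stdSimplex.face S ⊔ K) (SSet.stdSimplex.face {k})

lemma facesUnion_cons {n : ℕ} (k : Fin (n + 1)) (S : Finset (Fin (n + 1)))
    (l : List (Finset (Fin (n + 1)))) :
    facesUnion.{u} k (S :: l) = SSet.stdSimplex.face S ⊔ facesUnion k l := rfl

lemma facesUnion_nil {n : ℕ} (k : Fin (n + 1)) :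
    facesUnion.{u} k [] = SSet.stdSimplex.face {k} := rfl

lemma face_singleton_le_facesUnion {n : ℕ} (k : Fin (n + 1)) (l : List (Finset (Fin (n + 1)))) :
    SSet.stdSimplex.face {k} ≤ facesUnion.{u} k l := by
  induction l with
  | nil => exact le_rfl
  | cons S l ih => exact ih.trans le_sup_right

/-- Intersection distributes over unions, and since k ∈ S the vertex is unaffected. The result is
again a union of faces containing k, indexed by a list of the same length. -/
lemma face_inf_facesUnion {n : ℕ} (k : Fin (n + 1)) (S : Finset (Fin (n + 1))) (hS : k ∈ S)
    (l : List (Finset (Fin (n + 1)))) :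
    SSet.stdSimplex.face S ⊓ facesUnion.{u} k l = facesUnion k (l.map (S ⊓ ·)) := by
  induction l with
  | nil =>
    rw [List.map_nil, facesUnion_nil]
    rw [stdSimplex.face_inter_face]
    congr 1
    simpa using hS
  | cons S' l ih =>
    rw [List.map_cons, facesUnion_cons, facesUnion_cons, ← ih, ← SSet.stdSimplex.face_inter_face]
    ext m x
    exact and_or_left

lemma facesUnion_le_iff {n : ℕ} (k : Fin (n + 1)) (l : List (Finset (Fin (n + 1))))
    (K : (Δ[n] : SSet.{u}).Subcomplex) :
    facesUnion.{u} k l ≤ K ↔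
      SSet.stdSimplex.face {k} ≤ K ∧ ∀ S ∈ l, SSet.stdSimplex.face S ≤ K := by
  induction l with
  | nil => simp [facesUnion_nil]
  | cons S l ih => simp [facesUnion_cons, ih]; tauto

/-- A horn is the union of the facets through k. As the dimension is at least 1 there is such a
facet, so adding the vertex k changes nothing. -/
lemma horn_eq_facesUnion {n : ℕ} (k : Fin (n + 2)) :
    Λ[n + 1, k] = facesUnion.{u} k
      ((Finset.univ.toList.filter (· ≠ k)).map (fun j ↦ ({j}ᶜ : Finset (Fin (n + 2))))) := by
  apply le_antisymm
  · rw [horn_eq_iSup]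
    simp only [iSup_le_iff]
    rintro ⟨j, hj⟩
    refine ((facesUnion_le_iff k _ _).1 le_rfl).2 _ ?_
    simpa using hj
  · rw [facesUnion_le_iff]
    obtain ⟨j, hj⟩ := exists_ne k
    constructor
    · refine le_trans ?_ (face_le_horn _ _ hj)
      rw [stdSimplex.face_le_face_iff]
      simpa using hj
    · simp only [List.mem_map, List.mem_filter, forall_exists_index, and_imp]
      rintro _ i _ hi rfl
      exact face_le_horn _ _ (by simpa using hi)

variable {T : MorphismProperty SSet.{u}}

/-- A face is itself a standard simplex, of dimension one less than the cardinality of `S`, so the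
inclusion is one of the maps in `hvert`. -/
lemma face_singleton_homOfLE_mem [T.RespectsIso]
    (hvert : ∀ (n : ℕ) (φ : ⦋0⦌ ⟶ ⦋n⦌), T (SSet.stdSimplex.{u}.map φ))
    {n : ℕ} (k : Fin (n + 1)) (S : Finset (Fin (n + 1)))
    (h : SSet.stdSimplex.face.{u} {k} ≤ SSet.stdSimplex.face S) : T (Subcomplex.homOfLE h) := by
  rw [stdSimplex.face_le_face_iff] at h
  obtain ⟨m, hm⟩ : ∃ m, S.card = m + 1 :=
    Nat.exists_eq_succ_of_ne_zero (Finset.card_ne_zero_of_mem (h (by simp : k ∈ {k})))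
  let a := SSet.stdSimplex.isoOfRepresentableBy
    (SSet.stdSimplex.faceRepresentableBy.{u} S m (S.orderIsoOfFin hm))
  let b := SSet.stdSimplex.faceSingletonIso.{u} k
  obtain ⟨φ, hφ⟩ := SSet.stdSimplex.{u}.map_surjective
    (b.hom ≫ Subcomplex.homOfLE ((SSet.stdSimplex.face_le_face_iff _ _).2 h) ≫ a.inv)
  refine (T.arrow_mk_iso_iff (Arrow.isoMk b a ?_)).1 (hvert m φ)
  change b.hom ≫ Subcomplex.homOfLE ((SSet.stdSimplex.face_le_face_iff _ _).2 h) =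
    SSet.stdSimplex.map φ ≫ a.hom
  simp [hφ]

/-- The inclusion of a vertex of `Δ[n]` identifies to a map `Δ[0] ⟶ Δ[n]`. -/
lemma face_singleton_ι_mem [T.RespectsIso]
    (hvert : ∀ (n : ℕ) (φ : ⦋0⦌ ⟶ ⦋n⦌), T (SSet.stdSimplex.{u}.map φ))
    {n : ℕ} (k : Fin (n + 1)) : T (SSet.stdSimplex.face {k}).ι := by
  let b := SSet.stdSimplex.faceSingletonIso.{u} k
  obtain ⟨φ, hφ⟩ := SSet.stdSimplex.{u}.map_surjective (b.hom ≫ Subcomplex.ι _)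
  refine (T.arrow_mk_iso_iff (Arrow.isoMk b (Iso.refl _) ?_)).1 (hvert n φ)
  change b.hom ≫ Subcomplex.ι _ = SSet.stdSimplex.map φ ≫ 𝟙 _
  simp [hφ]

/-- The union S ∪ K is the pushout of S and K along S ∩ K. By induction {k} ⟶ S ∩ K lies in `T`, so
S ∩ K ⟶ S does by cancellation against {k} ⟶ S; its cobase change K ⟶ S ∪ K is then composed with
{k} ⟶ K. -/
lemma facesUnion_mem [T.IsStableUnderCobaseChange] [T.IsStableUnderComposition]
    (hT : ∀ ⦃X Y Z : SSet.{u}⦄ (f : X ⟶ Y) (g : Y ⟶ Z) [Mono g], T f → T (f ≫ g) → T g)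
    (hvert : ∀ (n : ℕ) (φ : ⦋0⦌ ⟶ ⦋n⦌), T (SSet.stdSimplex.{u}.map φ))
    {n : ℕ} (k : Fin (n + 1)) (l : List (Finset (Fin (n + 1))))
    (hl : ∀ S ∈ l, k ∈ S) :
    T (Subcomplex.homOfLE (face_singleton_le_facesUnion.{u} k l)) := by
  obtain ⟨m, hm⟩ : ∃ m, l.length = m := ⟨_, rfl⟩
  induction m generalizing l with
  | zero =>
    obtain rfl := List.length_eq_zero_iff.1 hm
    exact face_singleton_homOfLE_mem hvert k {k} _
  | succ m ih =>
    obtain _ | ⟨S, l⟩ := l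
    · simp at hm
    have hS : k ∈ S := hl S (by simp)
    have hl' : ∀ S ∈ l, k ∈ S := fun S hS ↦ hl S (by simp [hS])
    have h₁ := ih l hl' (by simpa using hm)
    -- This list is not the tail but has its length, which is why the induction runs over the
    -- length.
    have h₂ := ih (l.map (S ⊓ ·)) (by
      simp only [List.mem_map, forall_exists_index, and_imp]
      rintro _ S' hS' rfl
      simpa using ⟨hS, hl' _ hS'⟩) (by simpa using hm)
    have sq : Subcomplex.BicartSq (facesUnion.{u} k (l.map (S ⊓ ·))) (SSet.stdSimplex.face S)
        (facesUnion.{u} k l) (facesUnion.{u} k (S :: l)) :=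
      { sup_eq := rfl
        inf_eq := face_inf_facesUnion k S hS l }
    have h₃ : T (Subcomplex.homOfLE sq.le₁₂) :=
      hT _ _ h₂ (face_singleton_homOfLE_mem hvert k S
        ((face_singleton_le_facesUnion k _).trans sq.le₁₂))
    exact T.comp_mem _ _ h₁ (T.of_isPushout sq.isPushout.flip h₃)

/-- A class of morphisms of simplicial sets which is stable under composition, cobase change and
satisfies the right cancellation property for monomorphisms contains the horn inclusions as soon
as it contains the inclusions of the vertices in the standard simplices. -/
lemma horn_ι_mem [T.IsStableUnderCobaseChange] [T.IsStableUnderComposition]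
    (hT : ∀ ⦃X Y Z : SSet.{u}⦄ (f : X ⟶ Y) (g : Y ⟶ Z) [Mono g], T f → T (f ≫ g) → T g)
    (hvert : ∀ (n : ℕ) (φ : ⦋0⦌ ⟶ ⦋n⦌), T (SSet.stdSimplex.{u}.map φ))
    {n : ℕ} (k : Fin (n + 2)) : T Λ[n + 1, k].ι := by
  have h₁ := facesUnion_mem hT hvert k
    ((Finset.univ.toList.filter (· ≠ k)).map (fun j ↦ ({j}ᶜ : Finset (Fin (n + 2))))) (by
      simp only [List.mem_map, List.mem_filter, forall_exists_index, and_imp]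
      rintro _ i _ hi rfl
      simpa using (of_decide_eq_true hi).symm)
  revert h₁
  rw [horn_eq_facesUnion]
  exact fun h₁ ↦ hT _ _ h₁ (face_singleton_ι_mem hvert k)

end SimplicialSets

/-! ### Universal property and functoriality of coends. -/

section CoendBifunctor

variable {J : Type*} [Category* J] {A : Type*} [Category* A] {B : Type*} [Category* B]
  {M : Type*} [Category* M] [∀ (H : Jᵒᵖ ⥤ J ⥤ M), HasCoend H] (T : A ⥤ B ⥤ M)
  (G : J ⥤ A) (F : Jᵒᵖ ⥤ B)

/-- The canonical map to the coend of `(b, a) ↦ T(G a, F b)`. -/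
def coendBifunctorι (j : J) :
    (T.obj (G.obj j)).obj (F.obj (op j)) ⟶ ((coendBifunctor J T).obj G).obj F :=
  coend.ι (F ⋙ T.flip ⋙ (Functor.whiskeringLeft J A M).obj G) j

lemma coendBifunctorι_condition {i j : J} (f : i ⟶ j) :
    (T.obj (G.obj i)).map (F.map f.op) ≫ coendBifunctorι T G F i =
      (T.map (G.map f)).app (F.obj (op j)) ≫ coendBifunctorι T G F j :=
  coend.condition (F ⋙ T.flip ⋙ (Functor.whiskeringLeft J A M).obj G) f

variable {T G F} in
lemma coendBifunctor_hom_ext {W : M} {f g : ((coendBifunctor J T).obj G).obj F ⟶ W}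
    (h : ∀ j, coendBifunctorι T G F j ≫ f = coendBifunctorι T G F j ≫ g) : f = g :=
  coend.hom_ext h

variable {T G F} in
/-- The universal property of the coend of `(b, a) ↦ T(G a, F b)`. -/
def coendBifunctorDesc {W : M} (f : ∀ j, (T.obj (G.obj j)).obj (F.obj (op j)) ⟶ W)
    (hf : ∀ ⦃i j : J⦄ (g : i ⟶ j), (T.obj (G.obj i)).map (F.map g.op) ≫ f i =
      (T.map (G.map g)).app (F.obj (op j)) ≫ f j) :
    ((coendBifunctor J T).obj G).obj F ⟶ W :=
  coend.desc (F := F ⋙ T.flip ⋙ (Functor.whiskeringLeft J A M).obj G) f (fun _ _ g ↦ hf g)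

lemma coendBifunctorι_desc {W : M} (f : ∀ j, (T.obj (G.obj j)).obj (F.obj (op j)) ⟶ W)
    (hf : ∀ ⦃i j : J⦄ (g : i ⟶ j), (T.obj (G.obj i)).map (F.map g.op) ≫ f i =
      (T.map (G.map g)).app (F.obj (op j)) ≫ f j) (j : J) :
    coendBifunctorι T G F j ≫ coendBifunctorDesc f hf = f j :=
  coend.ι_desc _ _ _

lemma coendBifunctorι_obj_map {F' : Jᵒᵖ ⥤ B} (α : F ⟶ F') (j : J) :
    coendBifunctorι T G F j ≫ ((coendBifunctor J T).obj G).map α =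
      (T.obj (G.obj j)).map (α.app (op j)) ≫ coendBifunctorι T G F' j :=
  coend.ι_map _ _

variable {G} in
lemma coendBifunctorι_map_app {G' : J ⥤ A} (β : G ⟶ G') (j : J) :
    coendBifunctorι T G F j ≫ ((coendBifunctor J T).map β).app F =
      (T.map (β.app j)).app (F.obj (op j)) ≫ coendBifunctorι T G' F j :=
  coend.ι_map _ _

end CoendBifunctor

/-! ### The adjunction A ⊗ - ⊣ ℳ(A, -) on simplicial sets. -/

section TensorSSet

variable {M : Type w} [Category.{u} M]

/-- The functor `W ↦ ℳ(A, W)`, for a cosimplicial object `A`. -/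
def singSSet (A : CosimplicialObject M) : M ⥤ SSet.{u} where
  obj W := A.op ⋙ yoneda.obj W
  map g := Functor.whiskerLeft A.op (yoneda.map g)

variable [HasColimits M]

/-- The canonical map `A_n ⟶ A ⊗ K` attached to an `n`-simplex of `K`. -/
def tensorSSetι (A : CosimplicialObject M) (K : SSet.{u}) (n : SimplexCategory)
    (x : K.obj (op n)) : A.obj n ⟶ ((tensorSSet M).obj A).obj K :=
  Sigma.ι (fun _ : K.obj (op n) ↦ A.obj n) x ≫ coendBifunctorι sigmaConst.{u} A K n

lemma tensorSSetι_map (A : CosimplicialObject M) (K : SSet.{u}) {n m : SimplexCategory}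
    (φ : n ⟶ m) (x : K.obj (op m)) :
    tensorSSetι A K n (K.map φ.op x) = A.map φ ≫ tensorSSetι A K m x := by
  have := Sigma.ι (fun _ : K.obj (op m) ↦ A.obj n) x ≫=
    coendBifunctorι_condition sigmaConst.{u} A K φ
  simpa [tensorSSetι] using! this

lemma tensorSSet_hom_ext {A : CosimplicialObject M} {K : SSet.{u}} {W : M}
    {f g : ((tensorSSet M).obj A).obj K ⟶ W}
    (h : ∀ n x, tensorSSetι A K n x ≫ f = tensorSSetι A K n x ≫ g) : f = g := by
  refine coendBifunctor_hom_ext fun n ↦ Sigma.hom_ext _ _ fun x ↦ ?_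
  exact (Category.assoc _ _ _).symm.trans ((h n x).trans (Category.assoc _ _ _))

/-- The map out of `A ⊗ K` given by a map from `K` to `ℳ(A, W)`. -/
def tensorSSetDesc {A : CosimplicialObject M} {K : SSet.{u}} {W : M}
    (g : K ⟶ (singSSet A).obj W) : ((tensorSSet M).obj A).obj K ⟶ W :=
  coendBifunctorDesc (T := sigmaConst.{u}) (fun n ↦ Sigma.desc (fun x ↦ g.app (op n) x))
    (fun n m φ ↦ Sigma.hom_ext _ _ fun x ↦ by
      have h := ConcreteCategory.congr_hom (g.naturality φ.op) x
      simp
      exact h)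

lemma tensorSSetι_desc {A : CosimplicialObject M} {K : SSet.{u}} {W : M}
    (g : K ⟶ (singSSet A).obj W) (n : SimplexCategory) (x : K.obj (op n)) :
    tensorSSetι A K n x ≫ tensorSSetDesc g = g.app (op n) x := by
  refine (Category.assoc _ _ _).trans ?_
  refine (_ ≫= coendBifunctorι_desc (T := sigmaConst.{u}) A K _ _ n).trans ?_
  exact Sigma.ι_desc _ _

lemma tensorSSetι_obj_map (A : CosimplicialObject M) {K K' : SSet.{u}} (f : K ⟶ K')
    (n : SimplexCategory) (x : K.obj (op n)) :
    tensorSSetι A K n x ≫ ((tensorSSet M).obj A).map f = tensorSSetι A K' n (f.app _ x) := by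
  have := Sigma.ι (fun _ : K.obj (op n) ↦ A.obj n) x ≫=
    coendBifunctorι_obj_map sigmaConst.{u} A K f n
  refine (Category.assoc _ _ _).trans (this.trans ?_)
  simp [tensorSSetι]
  rfl

lemma tensorSSetι_map_app {A A' : CosimplicialObject M} (f : A ⟶ A') (K : SSet.{u})
    (n : SimplexCategory) (x : K.obj (op n)) :
    tensorSSetι A K n x ≫ ((tensorSSet M).map f).app K = f.app n ≫ tensorSSetι A' K n x := by
  have := Sigma.ι (fun _ : K.obj (op n) ↦ A.obj n) x ≫=
    coendBifunctorι_map_app sigmaConst.{u} K f n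
  refine (Category.assoc _ _ _).trans (this.trans ?_)
  simp [tensorSSetι]
  rfl

/-- The bijection between maps `A ⊗ K ⟶ W` and `K ⟶ ℳ(A, W)`. -/
def tensorSSetHomEquiv (A : CosimplicialObject M) (K : SSet.{u}) (W : M) :
    (((tensorSSet M).obj A).obj K ⟶ W) ≃ (K ⟶ (singSSet A).obj W) where
  toFun f :=
    { app := fun n ↦ ↾fun x ↦ tensorSSetι A K n.unop x ≫ f
      naturality := fun n m φ ↦ by
        ext x
        exact (tensorSSetι_map A K φ.unop x =≫ f).trans (Category.assoc _ _ _) }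
  invFun := tensorSSetDesc
  left_inv f := tensorSSet_hom_ext fun n x ↦ tensorSSetι_desc _ n x
  right_inv g := by
    ext n x
    exact tensorSSetι_desc g n.unop x

/-- The adjunction between `A ⊗ -` and `ℳ(A, -)`. -/
def tensorSSetAdj (A : CosimplicialObject M) : (tensorSSet M).obj A ⊣ singSSet A :=
  Adjunction.mkOfHomEquiv
    { homEquiv := tensorSSetHomEquiv A
      homEquiv_naturality_left_symm := fun {K K' W} f g ↦ tensorSSet_hom_ext fun n x ↦ by
        change _ ≫ tensorSSetDesc _ = _ ≫ _ ≫ tensorSSetDesc _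
        rw [tensorSSetι_desc, ← Category.assoc, tensorSSetι_obj_map, tensorSSetι_desc]
        rfl
      homEquiv_naturality_right := fun f g ↦ by
        ext n x
        exact (Category.assoc _ _ _).symm }

end TensorSSet

/-! ### The adjunction Γ ⊗_𝒞 - ⊣ ℳ(Γ, -) on simplicial presheaves. -/

section TensorU

variable {M : Type w} [Category.{u} M] [HasColimits M] {C : Type u} [Category.{u} C]

lemma tensorUι_eq (Γ : C ⥤ CosimplicialObject M) (F : U C) (c : C) (n : SimplexCategory)
    (x : (F.obj (op c)).obj (op n)) :
    tensorUι Γ F c n x = tensorSSetι (Γ.obj c) (F.obj (op c)) n x ≫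
      coendBifunctorι (tensorSSet M) Γ F c :=
  (Category.assoc _ _ _).symm

lemma tensorUι_map_simplex (Γ : C ⥤ CosimplicialObject M) (F : U C) (c : C)
    {n m : SimplexCategory} (φ : n ⟶ m) (x : (F.obj (op c)).obj (op m)) :
    tensorUι Γ F c n ((F.obj (op c)).map φ.op x) = (Γ.obj c).map φ ≫ tensorUι Γ F c m x := by
  rw [tensorUι_eq, tensorUι_eq]
  exact (tensorSSetι_map _ _ φ x =≫ _).trans (Category.assoc _ _ _)

lemma tensorUι_map_obj (Γ : C ⥤ CosimplicialObject M) (F : U C) {c d : C} (f : c ⟶ d)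
    (n : SimplexCategory) (x : (F.obj (op d)).obj (op n)) :
    tensorUι Γ F c n ((F.map f.op).app _ x) = (Γ.map f).app n ≫ tensorUι Γ F d n x := by
  rw [tensorUι_eq, tensorUι_eq]
  exact ((tensorSSetι_obj_map _ (F.map f.op) n x).symm =≫ _).trans <|
    (Category.assoc _ _ _).trans <|
    (_ ≫= coendBifunctorι_condition (tensorSSet M) Γ F f).trans <|
    (Category.assoc _ _ _).symm.trans <|
    (tensorSSetι_map_app (Γ.map f) _ n x =≫ _).trans (Category.assoc _ _ _)

lemma tensorU_hom_ext {Γ : C ⥤ CosimplicialObject M} {F : U C} {W : M}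
    {f g : ((tensorU M C).obj Γ).obj F ⟶ W}
    (h : ∀ c n x, tensorUι Γ F c n x ≫ f = tensorUι Γ F c n x ≫ g) : f = g := by
  refine coendBifunctor_hom_ext fun c ↦ tensorSSet_hom_ext fun n x ↦ ?_
  have := h c n x
  rw [tensorUι_eq] at this
  exact (Category.assoc _ _ _).symm.trans (this.trans (Category.assoc _ _ _))

/-- The map out of `Γ ⊗_𝒞 F` given by a map from `F` to `ℳ(Γ, W)`. -/
def tensorUDesc {Γ : C ⥤ CosimplicialObject M} {F : U C} {W : M}
    (g : F ⟶ (sing Γ).obj W) : ((tensorU M C).obj Γ).obj F ⟶ W :=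
  coendBifunctorDesc (T := tensorSSet M) (fun c ↦ tensorSSetDesc (g.app (op c)))
    (fun c d f ↦ tensorSSet_hom_ext fun n x ↦ by
      exact (Category.assoc _ _ _).symm.trans <|
        (tensorSSetι_obj_map _ (F.map f.op) n x =≫ _).trans <|
        (tensorSSetι_desc (g.app (op c)) n _).trans <|
        (ConcreteCategory.congr_hom (NatTrans.congr_app (g.naturality f.op) (op n)) x).trans <|
        Eq.symm <| (Category.assoc _ _ _).symm.trans <|
        (tensorSSetι_map_app (Γ.map f) _ n x =≫ _).trans <|
        (Category.assoc _ _ _).trans (_ ≫= tensorSSetι_desc (g.app (op d)) n x))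

lemma tensorUι_desc {Γ : C ⥤ CosimplicialObject M} {F : U C} {W : M}
    (g : F ⟶ (sing Γ).obj W) (c : C) (n : SimplexCategory) (x : (F.obj (op c)).obj (op n)) :
    tensorUι Γ F c n x ≫ tensorUDesc g = (g.app (op c)).app (op n) x := by
  rw [tensorUι_eq]
  exact (Category.assoc _ _ _).trans <|
    (_ ≫= coendBifunctorι_desc (T := tensorSSet M) Γ F _ _ c).trans (tensorSSetι_desc _ n x)

lemma tensorUι_obj_map (Γ : C ⥤ CosimplicialObject M) {F F' : U C} (f : F ⟶ F') (c : C)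
    (n : SimplexCategory) (x : (F.obj (op c)).obj (op n)) :
    tensorUι Γ F c n x ≫ ((tensorU M C).obj Γ).map f =
      tensorUι Γ F' c n ((f.app (op c)).app _ x) := by
  rw [tensorUι_eq, tensorUι_eq]
  exact (Category.assoc _ _ _).trans <|
    (_ ≫= coendBifunctorι_obj_map (tensorSSet M) Γ F f c).trans <|
    (Category.assoc _ _ _).symm.trans (tensorSSetι_obj_map _ (f.app (op c)) n x =≫ _)

lemma tensorUι_map_app {Γ Γ' : C ⥤ CosimplicialObject M} (f : Γ ⟶ Γ') (F : U C) (c : C)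
    (n : SimplexCategory) (x : (F.obj (op c)).obj (op n)) :
    tensorUι Γ F c n x ≫ ((tensorU M C).map f).app F =
      (f.app c).app n ≫ tensorUι Γ' F c n x := by
  rw [tensorUι_eq, tensorUι_eq]
  exact (Category.assoc _ _ _).trans <|
    (_ ≫= coendBifunctorι_map_app (tensorSSet M) F f c).trans <|
    (Category.assoc _ _ _).symm.trans <|
    (tensorSSetι_map_app (f.app c) _ n x =≫ _).trans (Category.assoc _ _ _)

/-- The bijection between maps `Γ ⊗_𝒞 F ⟶ W` and `F ⟶ ℳ(Γ, W)`. -/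
def tensorUHomEquiv (Γ : C ⥤ CosimplicialObject M) (F : U C) (W : M) :
    (((tensorU M C).obj Γ).obj F ⟶ W) ≃ (F ⟶ (sing Γ).obj W) where
  toFun f :=
    { app := fun c ↦
        { app := fun n ↦ ↾fun x ↦ tensorUι Γ F c.unop n.unop x ≫ f
          naturality := fun n m φ ↦ by
            ext x
            exact (tensorUι_map_simplex Γ F c.unop φ.unop x =≫ f).trans (Category.assoc _ _ _) }
      naturality := fun c d φ ↦ by
        ext n x
        exact (tensorUι_map_obj Γ F φ.unop n.unop x =≫ f).trans (Category.assoc _ _ _) }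
  invFun := tensorUDesc
  left_inv f := tensorU_hom_ext fun c n x ↦ tensorUι_desc _ c n x
  right_inv g := by
    ext c n x
    exact tensorUι_desc g c.unop n.unop x

/-- The adjunction between `Γ ⊗_𝒞 -` and `ℳ(Γ, -)`. -/
def tensorUAdj (Γ : C ⥤ CosimplicialObject M) : (tensorU M C).obj Γ ⊣ sing Γ :=
  Adjunction.mkOfHomEquiv
    { homEquiv := tensorUHomEquiv Γ
      homEquiv_naturality_left_symm := fun {F F' W} f g ↦ tensorU_hom_ext fun c n x ↦ by
        change _ ≫ tensorUDesc _ = _ ≫ _ ≫ tensorUDesc _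
        rw [tensorUι_desc, ← Category.assoc, tensorUι_obj_map, tensorUι_desc]
        rfl
      homEquiv_naturality_right := fun f g ↦ by
        ext c n x
        exact (Category.assoc _ _ _).symm }

lemma tensorUAdj_homEquiv_app (Γ : C ⥤ CosimplicialObject M) {F : U C} {W : M}
    (f : ((tensorU M C).obj Γ).obj F ⟶ W) (c : C) (n : SimplexCategory)
    (x : (F.obj (op c)).obj (op n)) :
    (((tensorUAdj Γ).homEquiv F W f).app (op c)).app (op n) x = tensorUι Γ F c n x ≫ f := by
  simp only [tensorUAdj, Adjunction.mkOfHomEquiv_homEquiv]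
  rfl

end TensorU

/-! ### Tensoring with standard simplices. -/

section StdSimplex

variable {M : Type w} [Category.{u} M] [HasColimits M] (A : CosimplicialObject M)

/-- The isomorphism `A_n ≅ A ⊗ Δ[n]`. -/
def tensorStdSimplexIso (n : SimplexCategory) :
    A.obj n ≅ ((tensorSSet M).obj A).obj (SSet.stdSimplex.{u}.obj n) where
  hom := tensorSSetι A _ n (SSet.stdSimplex.objEquiv.symm (𝟙 n))
  inv := tensorSSetDesc
    (SSet.yonedaEquiv.symm (𝟙 (A.obj n) : ((singSSet A).obj (A.obj n)).obj (op n)))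
  hom_inv_id := (tensorSSetι_desc _ _ _).trans (by
    change A.map (𝟙 n) ≫ 𝟙 _ = 𝟙 _
    rw [Category.comp_id]
    exact A.map_id n)
  inv_hom_id := tensorSSet_hom_ext fun m x ↦ by
    refine (Category.assoc _ _ _).symm.trans ((tensorSSetι_desc _ m x =≫ _).trans ?_)
    change (A.map (SSet.stdSimplex.objEquiv x) ≫ 𝟙 _) ≫ _ = _
    rw [Category.comp_id, Category.comp_id]
    exact (tensorSSetι_map A _ (SSet.stdSimplex.objEquiv x) _).symm.trans
      (congrArg _ (SSet.stdSimplex.objEquiv.injective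
        (Category.comp_id (SSet.stdSimplex.objEquiv x))))

lemma tensorStdSimplexIso_naturality {n m : SimplexCategory} (φ : n ⟶ m) :
    (tensorStdSimplexIso A n).hom ≫ ((tensorSSet M).obj A).map (SSet.stdSimplex.{u}.map φ) =
      A.map φ ≫ (tensorStdSimplexIso A m).hom :=
  (tensorSSetι_obj_map A (SSet.stdSimplex.{u}.map φ) n _).trans <|
    (congrArg _ (SSet.stdSimplex.objEquiv.injective
      ((Category.id_comp φ).trans (Category.comp_id φ).symm))).trans
    (tensorSSetι_map A _ φ (SSet.stdSimplex.objEquiv.symm (𝟙 m)))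

/-- The arrow `A_n ⟶ A_m` identifies to `A ⊗ Δ[n] ⟶ A ⊗ Δ[m]`. -/
def tensorStdSimplexArrowIso {n m : SimplexCategory} (φ : n ⟶ m) :
    Arrow.mk (A.map φ) ≅ Arrow.mk (((tensorSSet M).obj A).map (SSet.stdSimplex.{u}.map φ)) :=
  Arrow.isoMk (tensorStdSimplexIso A n) (tensorStdSimplexIso A m)
    (tensorStdSimplexIso_naturality A φ)

lemma hasLiftingProperty_stdSimplex_map_iff {n m : SimplexCategory} (φ : n ⟶ m) {E B : M}
    (p : E ⟶ B) :
    HasLiftingProperty (SSet.stdSimplex.{u}.map φ) ((singSSet A).map p) ↔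
      HasLiftingProperty (A.map φ) p := by
  rw [← (tensorSSetAdj A).hasLiftingProperty_iff]
  exact (HasLiftingProperty.iff_of_arrow_iso_left (tensorStdSimplexArrowIso A φ) p).symm

end StdSimplex

/-! ### Latching objects as tensors with boundaries. -/

section Latching

variable {M : Type w} [Category.{u} M] [HasColimits M] (A : CosimplicialObject M)

/-- The canonical map `A_k ⟶ L_n A` attached to an injective map `[k] ⟶ [n]` which is not an
isomorphism. -/
def latchingι {n k : SimplexCategory} (f : k ⟶ n) (hf : Mono f ∧ ¬ IsIso f) :
    A.obj k ⟶ latchingObj A n :=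
  colimit.ι (latchingDiagram A n) ⟨Over.mk f, hf⟩

lemma latchingι_latchingMap {n k : SimplexCategory} (f : k ⟶ n) (hf : Mono f ∧ ¬ IsIso f) :
    latchingι A f hf ≫ latchingMap A n = A.map f :=
  colimit.ι_desc _ _

variable {A} in
lemma latchingObj_hom_ext {n : SimplexCategory} {W : M} {f g : latchingObj A n ⟶ W}
    (h : ∀ (k : SimplexCategory) (i : k ⟶ n) (hi : Mono i ∧ ¬ IsIso i),
      latchingι A i hi ≫ f = latchingι A i hi ≫ g) : f = g :=
  colimit.hom_ext fun j ↦ h j.obj.left j.obj.hom j.property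

lemma latchingι_map {n k l : SimplexCategory} (f : k ⟶ n) (hf : Mono f ∧ ¬ IsIso f)
    (g : l ⟶ n) (hg : Mono g ∧ ¬ IsIso g) (φ : k ⟶ l) (h : φ ≫ g = f) :
    A.map φ ≫ latchingι A g hg = latchingι A f hf :=
  colimit.w (latchingDiagram A n) (j' := ⟨Over.mk f, hf⟩) (j := ⟨Over.mk g, hg⟩)
    (ObjectProperty.homMk (Over.homMk φ h))

lemma image_ι_mono_and_not_isIso {n m : SimplexCategory} (x : m ⟶ n)
    (hx : ¬ Function.Surjective x.toOrderHom) : Mono (image.ι x) ∧ ¬ IsIso (image.ι x) :=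
  ⟨inferInstance, fun _ ↦ hx (by
    have : Epi (factorThruImage x ≫ image.ι x) := epi_comp _ _
    rw [image.fac] at this
    exact SimplexCategory.epi_iff_surjective.1 this)⟩

/-- The canonical map `A_k ⟶ L_n A` attached to a non surjective map `[k] ⟶ [n]`. -/
def latchingOfNotSurjective {n m : SimplexCategory} (x : m ⟶ n)
    (hx : ¬ Function.Surjective x.toOrderHom) : A.obj m ⟶ latchingObj A n :=
  A.map (factorThruImage x) ≫ latchingι A (image.ι x) (image_ι_mono_and_not_isIso x hx)

/-- The image is initial among the mono factorisations of `x`, so it maps to the given one inside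
the latching category. Hence any mono factorisation may be used to compute
`latchingOfNotSurjective`. -/
lemma map_latchingι {n m k : SimplexCategory} (x : m ⟶ n)
    (hx : ¬ Function.Surjective x.toOrderHom) (g : m ⟶ k) (f : k ⟶ n)
    (hf : Mono f ∧ ¬ IsIso f) (fac : g ≫ f = x) :
    A.map g ≫ latchingι A f hf = latchingOfNotSurjective A x hx := by
  have := hf.1
  let F : MonoFactorisation x := { I := k, m := f, e := g, fac := fac }
  have h₁ : image.lift F ≫ f = image.ι x := image.lift_fac F
  have h₂ : factorThruImage x ≫ image.lift F = g := image.fac_lift F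
  rw [latchingOfNotSurjective,
    ← latchingι_map A (image.ι x) (image_ι_mono_and_not_isIso x hx) f hf _ h₁]
  rw [← h₂, A.map_comp, Category.assoc]

lemma not_surjective_comp {n m k : SimplexCategory} (x : m ⟶ n) (φ : k ⟶ m)
    (hx : ¬ Function.Surjective x.toOrderHom) :
    ¬ Function.Surjective (φ ≫ x).toOrderHom :=
  fun h ↦ hx (Function.Surjective.of_comp (g := φ.toOrderHom) h)

lemma map_latchingOfNotSurjective {n m k : SimplexCategory} (x : m ⟶ n)
    (hx : ¬ Function.Surjective x.toOrderHom) (φ : k ⟶ m) :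
    A.map φ ≫ latchingOfNotSurjective A x hx =
      latchingOfNotSurjective A (φ ≫ x) (not_surjective_comp x φ hx) := by
  rw [← map_latchingι A (φ ≫ x) (not_surjective_comp x φ hx) (φ ≫ factorThruImage x) (image.ι x)
    (image_ι_mono_and_not_isIso x hx) (by simp), latchingOfNotSurjective, A.map_comp,
    Category.assoc]

lemma not_surjective_of_mono {n k : SimplexCategory} (f : k ⟶ n) (hf : Mono f ∧ ¬ IsIso f) :
    ¬ Function.Surjective f.toOrderHom := fun h ↦
  hf.2 (SimplexCategory.isIso_of_bijective ⟨SimplexCategory.mono_iff_injective.1 hf.1, h⟩)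

/-- The map `∂Δ[n] ⟶ ℳ(A, L_n A)`. -/
def boundaryToSing (n : ℕ) : (∂Δ[n] : SSet.{u}) ⟶ (singSSet A).obj (latchingObj A ⦋n⦌) where
  app m := ↾fun x ↦ latchingOfNotSurjective A (SSet.stdSimplex.objEquiv x.1) x.2
  naturality m k φ := by
    ext x
    exact (map_latchingOfNotSurjective A (SSet.stdSimplex.objEquiv x.1) x.2 φ.unop).symm

/-- The latching object `L_n A` identifies to `A ⊗ ∂Δ[n]`. -/
def latchingObjIso (n : ℕ) : latchingObj A ⦋n⦌ ≅ ((tensorSSet M).obj A).obj (∂Δ[n] : SSet.{u}) where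
  hom := colimit.desc (latchingDiagram A ⦋n⦌)
    { pt := ((tensorSSet M).obj A).obj (∂Δ[n] : SSet.{u})
      ι :=
        { app := fun f ↦ tensorSSetι A (∂Δ[n] : SSet.{u}) f.obj.left
            ⟨SSet.stdSimplex.objEquiv.symm f.obj.hom, not_surjective_of_mono _ f.property⟩
          naturality := fun f g φ ↦ by
            have h : φ.hom.left ≫ g.obj.hom = f.obj.hom := Over.w φ.hom
            refine Eq.trans ?_ (Category.comp_id _).symm
            refine (tensorSSetι_map A (∂Δ[n] : SSet.{u}) φ.hom.left _).symm.trans (congrArg _ ?_)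
            exact Subtype.ext (SSet.stdSimplex.objEquiv.injective h) } }
  inv := tensorSSetDesc (boundaryToSing A n)
  hom_inv_id := latchingObj_hom_ext fun k i hi ↦ by
    refine (Category.assoc _ _ _).symm.trans ((colimit.ι_desc _ _ =≫ _).trans ?_)
    refine (tensorSSetι_desc (boundaryToSing A n) k _).trans ?_
    refine (map_latchingι A i (not_surjective_of_mono i hi) (𝟙 k) i hi
      (Category.id_comp i)).symm.trans ?_
    rw [A.map_id, Category.id_comp, Category.comp_id]
  -- A simplex of the boundary is the restriction, along the epi part of its image factorisation, of
  -- the simplex given by the mono part.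
  inv_hom_id := tensorSSet_hom_ext fun k x ↦ by
    refine (Category.assoc _ _ _).symm.trans ((tensorSSetι_desc _ k x =≫ _).trans ?_)
    refine (Category.assoc _ _ _).trans
      ((A.map _ ≫= colimit.ι_desc _ (⟨Over.mk (image.ι (SSet.stdSimplex.objEquiv x.1)),
        image_ι_mono_and_not_isIso _ x.2⟩ : LatchingCategory ⦋n⦌)).trans ?_)
    refine Eq.trans ?_ (Category.comp_id _).symm
    refine (tensorSSetι_map A (∂Δ[n] : SSet.{u})
      (factorThruImage (SSet.stdSimplex.objEquiv x.1)) _).symm.trans (congrArg _ ?_)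
    exact Subtype.ext (SSet.stdSimplex.objEquiv.injective
      (image.fac (SSet.stdSimplex.objEquiv x.1)))

/-- The latching map `L_n A ⟶ A_n` identifies to `A ⊗ ∂Δ[n] ⟶ A ⊗ Δ[n]`. -/
def latchingMapArrowIso (n : ℕ) :
    Arrow.mk (latchingMap A ⦋n⦌) ≅ Arrow.mk (((tensorSSet M).obj A).map (SSet.boundary.{u} n).ι) :=
  Arrow.isoMk (latchingObjIso A n) (tensorStdSimplexIso A ⦋n⦌) (latchingObj_hom_ext fun k i hi ↦ by
    refine (Category.assoc _ _ _).symm.trans ((colimit.ι_desc _ _ =≫ _).trans ?_)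
    refine (tensorSSetι_obj_map A (SSet.boundary.{u} n).ι k _).trans ?_
    refine Eq.trans ?_ (Category.assoc _ _ _)
    refine Eq.trans ?_ ((latchingι_latchingMap A i hi).symm =≫ _)
    refine Eq.trans (congrArg _ (SSet.stdSimplex.objEquiv.injective (Category.comp_id i).symm))
      (tensorSSetι_map A _ i _))

lemma hasLiftingProperty_boundary_ι_iff (n : ℕ) {E B : M} (p : E ⟶ B) :
    HasLiftingProperty (SSet.boundary.{u} n).ι ((singSSet A).map p) ↔
      HasLiftingProperty (latchingMap A ⦋n⦌) p := by
  rw [← (tensorSSetAdj A).hasLiftingProperty_iff]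
  exact (HasLiftingProperty.iff_of_arrow_iso_left (latchingMapArrowIso A n) p).symm

end Latching

/-! ### Reedy cofibrancy, fibrations and lifting properties. -/

section Reedy

open SSet.modelCategoryQuillen

variable {M : Type w} [Category.{u} M] [ModelCategory M] [HasColimits M]
  {A : CosimplicialObject M}

/-- A cosimplicial object `A` is Reedy cofibrant if and only if `ℳ(A, -)` preserves
trivial fibrations. -/
lemma isReedyCofibrant_iff :
    IsReedyCofibrant A ↔ ∀ ⦃E B : M⦄ (p : E ⟶ B), trivialFibrations M p →
      (cofibrations SSet.{u}).rlp ((singSSet A).map p) := by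
  constructor
  · intro hA E B p hp
    -- The boundary inclusions generate the monomorphisms, and tensoring them with `A` gives the
    -- latching maps.
    rw [cofibrations_eq, SSet.rlp_monomorphisms]
    rintro _ _ _ ⟨n⟩
    rw [hasLiftingProperty_boundary_ι_iff]
    have := hA ⦋n⦌
    rw [HomotopicalAlgebra.cofibration_iff, ← trivialFibrations_llp] at this
    exact this _ hp
  · intro h n
    induction n using SimplexCategory.rec with | _ n
    rw [HomotopicalAlgebra.cofibration_iff, ← trivialFibrations_llp]
    intro E B p hp
    rw [← hasLiftingProperty_boundary_ι_iff]
    exact h p hp _ (inferInstanceAs (Mono _))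

/-- The class of maps of simplicial sets `f` such that `A ⊗ f` is a trivial cofibration. -/
abbrev tensorTrivialCofibrations (A : CosimplicialObject M) : MorphismProperty SSet.{u} :=
  (trivialCofibrations M).inverseImage ((tensorSSet M).obj A)

/-- As a left adjoint, A ⊗ - preserves pushout squares. -/
instance : (tensorTrivialCofibrations A).IsStableUnderCobaseChange where
  of_isPushout sq hg := by
    have := (tensorSSetAdj A).leftAdjoint_preservesColimits
    exact MorphismProperty.of_isPushout (P := trivialCofibrations M)
      (sq.map ((tensorSSet M).obj A)) hg

lemma cofibrations_tensorSSet_map (hA : IsReedyCofibrant A) {K K' : SSet.{u}} (f : K ⟶ K')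
    [Mono f] : cofibrations M (((tensorSSet M).obj A).map f) := by
  rw [← trivialFibrations_llp]
  intro E B p hp
  rw [(tensorSSetAdj A).hasLiftingProperty_iff]
  exact isReedyCofibrant_iff.1 hA p hp _ (inferInstanceAs (Mono f))

/-- If `A` is Reedy cofibrant and all the maps `A_0 ⟶ A_n` are weak equivalences, then `ℳ(A, -)`
preserves fibrations. -/
lemma fibrations_singSSet_map (hA : IsReedyCofibrant A)
    (hA' : ∀ (n : ℕ) (φ : ⦋0⦌ ⟶ ⦋n⦌), WeakEquivalence (A.map φ)) {E B : M} (p : E ⟶ B)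
    (hp : fibrations M p) : fibrations SSet.{u} ((singSSet A).map p) := by
  have key : ∀ (n : ℕ) (k : Fin (n + 2)), tensorTrivialCofibrations A Λ[n + 1, k].ι := by
    intro n k
    apply horn_ι_mem
    -- Right cancellation: `g` is mono, which gives the cofibration, and two-out-of-three gives the
    -- weak equivalence.
    · intro X Y Z f g _ hf hfg
      refine ⟨cofibrations_tensorSSet_map hA g, ?_⟩
      have h := hfg.2
      rw [Functor.map_comp] at h
      exact MorphismProperty.of_precomp _ _ _ hf.2 h
    · intro n φ
      -- A vertex is a split monomorphism because [0] is terminal.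
      have w : SSet.stdSimplex.{u}.map φ ≫
          SSet.stdSimplex.{u}.map (SimplexCategory.const ⦋n⦌ ⦋0⦌ 0) = 𝟙 _ := by
        rw [← SSet.stdSimplex.{u}.map_comp, ← SSet.stdSimplex.{u}.map_id]
        exact congrArg _ (Subsingleton.elim _ _)
      have : Mono (SSet.stdSimplex.{u}.map φ) := mono_of_mono_fac w
      refine ⟨cofibrations_tensorSSet_map hA _, ?_⟩
      exact ((weakEquivalences M).arrow_mk_iso_iff (tensorStdSimplexArrowIso A φ)).1
        ((weakEquivalence_iff _).1 (hA' n φ))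
  intro _ _ j hj
  simp only [J, MorphismProperty.iSup_iff] at hj
  obtain ⟨n, ⟨k⟩⟩ := hj
  rw [← (tensorSSetAdj A).hasLiftingProperty_iff]
  have : trivialCofibrations M _ := key n k
  rw [← fibrations_llp] at this
  exact this _ hp

/-- If `ℳ(A, -)` preserves fibrations, then for all `n`, there is a map `A_0 ⟶ A_n` which is a
weak equivalence. -/
lemma exists_weakEquivalence_map
    (hA : ∀ ⦃E B : M⦄ (p : E ⟶ B), fibrations M p → fibrations SSet.{u} ((singSSet A).map p))
    (n : SimplexCategory) : ∃ φ : ⦋0⦌ ⟶ n, WeakEquivalence (A.map φ) := by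
  obtain ⟨φ, hφ⟩ := exists_anodyneExtensions_stdSimplex_map.{u} n
  refine ⟨φ, ?_⟩
  -- By adjunction, lifting `A.map φ` against `p` is lifting the anodyne vertex against the Kan
  -- fibration ℳ(A, p).
  have : trivialCofibrations M (A.map φ) := by
    rw [← fibrations_llp]
    intro E B p hp
    rw [← hasLiftingProperty_stdSimplex_map_iff]
    exact hφ _ (hA p hp)
  exact (weakEquivalence_iff _).2 this.2

end Reedy

/-! ### Yoneda for the presheaves rX ⊗ Δ[n]. -/

section Yoneda

variable {C : Type u} [Category.{u} C]

/-- The tautological `n`-simplex of `rX ⊗ Δ[n]` over `X`. -/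
def tautSimplex (X : C) (n : SimplexCategory) :
    ((((rTensorSimplex C).obj X).obj n).obj (op X)).obj (op n) :=
  (𝟙 X, SSet.stdSimplex.objEquiv.symm (𝟙 n))

/-- The map `rX ⊗ Δ[n] ⟶ F` attached to an `n`-simplex of `F(X)`. -/
def simplexHom {F : U C} {X : C} {n : SimplexCategory} (x : (F.obj (op X)).obj (op n)) :
    ((rTensorSimplex C).obj X).obj n ⟶ F where
  app c :=
    { app := fun m ↦ ↾fun y ↦
        (F.map (Quiver.Hom.op (show c.unop ⟶ X from y.1))).app m
          ((F.obj (op X)).map (SSet.stdSimplex.objEquiv y.2).op x)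
      naturality := fun m k φ ↦ by
        ext y
        have h₁ := ConcreteCategory.congr_hom ((F.obj (op X)).map_comp
          (SSet.stdSimplex.objEquiv y.2).op φ) x
        have h₂ := ConcreteCategory.congr_hom
          ((F.map (Quiver.Hom.op (show c.unop ⟶ X from y.1))).naturality φ)
          ((F.obj (op X)).map (SSet.stdSimplex.objEquiv y.2).op x)
        exact (congrArg ((F.map (Quiver.Hom.op (show c.unop ⟶ X from y.1))).app k) h₁).trans h₂ }
  naturality c d f := by
    ext m y
    exact ConcreteCategory.congr_hom (NatTrans.congr_app (F.map_comp
      (Quiver.Hom.op (show c.unop ⟶ X from y.1)) f) m) _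

lemma simplexHom_app_tautSimplex {F : U C} {X : C} {n : SimplexCategory}
    (x : (F.obj (op X)).obj (op n)) :
    ((simplexHom x).app (op X)).app (op n) (tautSimplex X n) = x := by
  have h₁ := ConcreteCategory.congr_hom ((F.obj (op X)).map_id (op n)) x
  have h₂ := ConcreteCategory.congr_hom (NatTrans.congr_app (F.map_id (op X)) (op n)) x
  exact (congrArg ((F.map (𝟙 (op X))).app (op n)) h₁).trans h₂

lemma simplexHom_tautSimplex {F : U C} {X : C} {n : SimplexCategory}
    (g : ((rTensorSimplex C).obj X).obj n ⟶ F) :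
    simplexHom ((g.app (op X)).app (op n) (tautSimplex X n)) = g := by
  ext c m y
  have h₁ := ConcreteCategory.congr_hom ((g.app (op X)).naturality
    (SSet.stdSimplex.objEquiv y.2).op) (tautSimplex X n)
  have h₂ := ConcreteCategory.congr_hom (NatTrans.congr_app (g.naturality
    (Quiver.Hom.op (show c.unop ⟶ X from y.1))) m)
      (((((rTensorSimplex C).obj X).obj n).obj (op X)).map (SSet.stdSimplex.objEquiv y.2).op
        (tautSimplex X n))
  refine (congrArg ((F.map (Quiver.Hom.op (show c.unop ⟶ X from y.1))).app m) h₁.symm).trans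
    (h₂.symm.trans (congrArg ((g.app c).app m) ?_))
  exact Prod.ext (Category.comp_id (show c.unop ⟶ X from y.1))
    (SSet.stdSimplex.objEquiv.injective (Category.comp_id (SSet.stdSimplex.objEquiv y.2)))

lemma rTensorSimplex_hom_ext {F : U C} {X : C} {n : SimplexCategory}
    {f g : ((rTensorSimplex C).obj X).obj n ⟶ F}
    (h : (f.app (op X)).app (op n) (tautSimplex X n) =
      (g.app (op X)).app (op n) (tautSimplex X n)) : f = g := by
  rw [← simplexHom_tautSimplex f, ← simplexHom_tautSimplex g, h]

/-- The Yoneda bijection for the simplicial presheaves `rX ⊗ Δ[n]`. -/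
def rTensorSimplexEquiv (F : U C) (X : C) (n : SimplexCategory) :
    (F.obj (op X)).obj (op n) ≃ (((rTensorSimplex C).obj X).obj n ⟶ F) where
  toFun := simplexHom
  invFun g := (g.app (op X)).app (op n) (tautSimplex X n)
  left_inv := simplexHom_app_tautSimplex
  right_inv := simplexHom_tautSimplex

lemma simplexHom_comp {F G : U C} {X : C} {n : SimplexCategory} (x : (F.obj (op X)).obj (op n))
    (g : F ⟶ G) : simplexHom x ≫ g = simplexHom ((g.app (op X)).app (op n) x) :=
  rTensorSimplex_hom_ext (by
    rw [simplexHom_app_tautSimplex]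
    exact congrArg _ (simplexHom_app_tautSimplex x))

lemma map_simplexHom {F : U C} {X : C} {n m : SimplexCategory} (φ : n ⟶ m)
    (x : (F.obj (op X)).obj (op m)) :
    ((rTensorSimplex C).obj X).map φ ≫ simplexHom x =
      simplexHom ((F.obj (op X)).map φ.op x) :=
  rTensorSimplex_hom_ext (by
    refine Eq.trans ?_ (simplexHom_app_tautSimplex _).symm
    change (F.map (𝟙 X).op).app (op n) ((F.obj (op X)).map (𝟙 n ≫ φ).op x) = _
    rw [Category.id_comp]
    exact ConcreteCategory.congr_hom (NatTrans.congr_app (F.map_id (op X)) (op n)) _)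

lemma map_app_simplexHom {F : U C} {X Y : C} {n : SimplexCategory} (f : X ⟶ Y)
    (x : (F.obj (op Y)).obj (op n)) :
    ((rTensorSimplex C).map f).app n ≫ simplexHom x =
      simplexHom ((F.map f.op).app (op n) x) :=
  rTensorSimplex_hom_ext (by
    refine Eq.trans ?_ (simplexHom_app_tautSimplex _).symm
    change (F.map (𝟙 X ≫ f).op).app (op n) ((F.obj (op Y)).map (𝟙 n).op x) = _
    rw [Category.id_comp]
    exact congrArg ((F.map f.op).app (op n))
      (ConcreteCategory.congr_hom ((F.obj (op Y)).map_id (op n)) x))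

lemma rTensorSimplexProj_naturality (X : C) {n m : SimplexCategory} (φ : n ⟶ m) :
    ((rTensorSimplex C).obj X).map φ ≫ rTensorSimplexProj C X m = rTensorSimplexProj C X n :=
  rfl

lemma rTensorSimplexProj_naturality_obj {X Y : C} (f : X ⟶ Y) (n : SimplexCategory) :
    ((rTensorSimplex C).map f).app n ≫ rTensorSimplexProj C Y n =
      rTensorSimplexProj C X n ≫ (r C).map f :=
  rfl

/-- As rY is discrete, `f` is a simplex in every degree; this identity later matches `η` with the
augmentation. -/
lemma rTensorSimplexProj_eq_simplexHom {X Y : C} (f : X ⟶ Y) (n : SimplexCategory) :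
    rTensorSimplexProj C X n ≫ (r C).map f =
      simplexHom (F := (r C).obj Y) (X := X) (n := n) f :=
  rTensorSimplex_hom_ext (by
    refine Eq.trans ?_ (simplexHom_app_tautSimplex _).symm
    exact Category.id_comp f)

end Yoneda

/-! ### From Quillen factorizations to cosimplicial resolutions. -/

section FactorizationToCoRes

variable {C : Type u} [Category.{u} C] {M : Type w} [Category.{u} M] [ModelCategory M]
  {γ : C ⥤ M} (P : Factorization γ)

/-- The bijection between the `n`-simplices of `(R W)(X)` and the maps `L(rX ⊗ Δ[n]) ⟶ W`. -/
def Factorization.simplexEquiv (W : M) (X : C) (n : SimplexCategory) :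
    ((P.R.obj W).obj (op X)).obj (op n) ≃
      (P.L.obj (((rTensorSimplex C).obj X).obj n) ⟶ W) :=
  (rTensorSimplexEquiv (P.R.obj W) X n).trans (P.adj.homEquiv _ W).symm

/-- The isomorphism between `R` and `ℳ(Γ, -)`, where `Γ(X)_n = L(rX ⊗ Δ[n])`. -/
def Factorization.singIso : P.R ≅ sing ((Factorization.cosimplicial γ).obj P) :=
  NatIso.ofComponents (fun W ↦ NatIso.ofComponents (fun X ↦ NatIso.ofComponents
      (fun n ↦ (P.simplexEquiv W X.unop n.unop).toIso)
      (fun {n m} φ ↦ by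
        ext x
        change (P.adj.homEquiv _ W).symm (simplexHom (((P.R.obj W).obj X).map φ x)) =
          P.L.map (((rTensorSimplex C).obj X.unop).map φ.unop) ≫
            (P.adj.homEquiv _ W).symm (simplexHom x)
        rw [← P.adj.homEquiv_naturality_left_symm, map_simplexHom]
        rfl))
      (fun {X Y} f ↦ by
        ext n x
        change (P.adj.homEquiv _ W).symm (simplexHom (((P.R.obj W).map f).app n x)) =
          P.L.map (((rTensorSimplex C).map f.unop).app n.unop) ≫
            (P.adj.homEquiv _ W).symm (simplexHom x)
        rw [← P.adj.homEquiv_naturality_left_symm, map_app_simplexHom]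
        rfl))
    (fun {W W'} g ↦ by
      ext X n x
      change (P.adj.homEquiv _ W').symm (simplexHom (((P.R.map g).app X).app n x)) =
          (P.adj.homEquiv _ W).symm (simplexHom x) ≫ g
      rw [← P.adj.homEquiv_naturality_right_symm, simplexHom_comp])

lemma Factorization.singIso_hom_app_app_app (W : M) (X : C) (n : SimplexCategory)
    (x : ((P.R.obj W).obj (op X)).obj (op n)) :
    ((P.singIso.hom.app W).app (op X)).app (op n) x =
      (P.adj.homEquiv (((rTensorSimplex C).obj X).obj n) W).symm (simplexHom x) :=
  rfl

/-- On arrows, `R` evaluated at `X` identifies to `ℳ(Γ(X), -)`. -/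
def Factorization.singArrowIso (X : C) {E B : M} (p : E ⟶ B) :
    Arrow.mk ((P.R.map p).app (op X)) ≅
      Arrow.mk ((singSSet (((Factorization.cosimplicial γ).obj P).obj X)).map p) :=
  Arrow.isoMk ((P.singIso.app E).app (op X)) ((P.singIso.app B).app (op X))
    (NatTrans.congr_app (P.singIso.hom.naturality p).symm (op X))

open SSet.modelCategoryQuillen in
lemma trivialFibrations_U_iff {F G : U C} (f : F ⟶ G) :
    trivialFibrations (U C) f ↔ ∀ X, (cofibrations SSet.{u}).rlp (f.app X) :=
  ⟨fun h X ↦ (fibrations_and_sSetWeakEquivalences_iff _).1 ⟨h.1 X, h.2 X⟩,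
    fun h ↦ ⟨fun X ↦ ((fibrations_and_sSetWeakEquivalences_iff _).2 (h X)).1,
      fun X ↦ ((fibrations_and_sSetWeakEquivalences_iff _).2 (h X)).2⟩⟩

/-- The augmentation `L(rX ⊗ Δ[n]) ⟶ L(rX) ⟶ γ(X)`. -/
def Factorization.aug :
    (Factorization.cosimplicial γ).obj P ⟶ γ ⋙ CosimplicialObject.const M where
  app X :=
    { app := fun n ↦ P.L.map (rTensorSimplexProj C X n) ≫ P.η.app X
      naturality := fun n m φ ↦ by
        refine Eq.trans ?_ (Category.comp_id _).symm
        refine (Category.assoc _ _ _).symm.trans ?_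
        exact ((P.L.map_comp _ _).symm.trans
          (congrArg P.L.map (rTensorSimplexProj_naturality X φ))) =≫ _ }
  naturality X Y f := by
    ext n
    have h := (P.L.map_comp _ _).symm.trans
      ((congrArg P.L.map (rTensorSimplexProj_naturality_obj f n)).trans (P.L.map_comp _ _))
    exact (Category.assoc _ _ _).symm.trans <| (h =≫ P.η.app Y).trans <|
      (Category.assoc _ _ _).trans <| (_ ≫= P.η.naturality f).trans (Category.assoc _ _ _).symm

variable [HasColimits M]

/-- Evaluated at X, the right adjoint is ℳ(Γ(X), -), and trivial fibrations of presheaves are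
detected objectwise. -/
lemma Factorization.isReedyCofibrant (X : C) :
    IsReedyCofibrant (((Factorization.cosimplicial γ).obj P).obj X) :=
  isReedyCofibrant_iff.2 fun _ _ p hp ↦
    (MorphismProperty.arrow_mk_iso_iff _ (P.singArrowIso X p)).1
      ((trivialFibrations_U_iff _).1 (P.isQuillenPair.map_trivialFibration p hp) (op X))

lemma Factorization.exists_weakEquivalence (X : C) (n : SimplexCategory) :
    ∃ φ : ⦋0⦌ ⟶ n, WeakEquivalence (P.L.map (((rTensorSimplex C).obj X).map φ)) :=
  exists_weakEquivalence_map (A := ((Factorization.cosimplicial γ).obj P).obj X)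
    (fun _ _ p hp ↦ (MorphismProperty.arrow_mk_iso_iff _ (P.singArrowIso X p)).1
      (P.isQuillenPair.map_fibration p hp (op X))) n

/-- The projection `rX ⊗ Δ[0] ⟶ rX` is an isomorphism. -/
lemma isIso_rTensorSimplexProj_zero (X : C) : IsIso (rTensorSimplexProj C X ⦋0⦌) := by
  let t : (r C).obj X ⟶ (Functor.const Cᵒᵖ).obj (SSet.stdSimplex.{u}.obj ⦋0⦌) :=
    { app := fun c ↦
        { app := fun m ↦ ↾fun _ ↦
            SSet.stdSimplex.objEquiv.symm (SimplexCategory.const m.unop ⦋0⦌ 0) } }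
  refine ⟨CartesianMonoidalCategory.lift (𝟙 _) t, ?_, rfl⟩
  ext c m y
  exact Prod.ext rfl (SSet.stdSimplex.objEquiv.injective (Subsingleton.elim _ _))

/-- Composing the projection with the vertex `φ` gives rX ⊗ Δ[0] ⟶ rX, an isomorphism. Since L sends
`φ` to a weak equivalence, two-out-of-three applies, so one good vertex in each degree suffices. -/
lemma Factorization.weakEquivalence_aug (X : C) (n : SimplexCategory) :
    WeakEquivalence ((P.aug.app X).app n) := by
  obtain ⟨φ, hφ⟩ := P.exists_weakEquivalence X n
  have := isIso_rTensorSimplexProj_zero X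
  have := P.weakEquivalence_η X
  have h₁ : P.L.map (((rTensorSimplex C).obj X).map φ) ≫ P.L.map (rTensorSimplexProj C X n) =
      P.L.map (rTensorSimplexProj C X ⦋0⦌) := (P.L.map_comp _ _).symm
  have h₂ : WeakEquivalence (P.L.map (rTensorSimplexProj C X ⦋0⦌)) := inferInstance
  have h₃ : WeakEquivalence (P.L.map (rTensorSimplexProj C X n)) :=
    weakEquivalence_of_precomp_of_fac h₁
  exact inferInstanceAs (WeakEquivalence (P.L.map (rTensorSimplexProj C X n) ≫ P.η.app X))

variable (γ) in
/-- The functor which sends a factorization `(L, R, η)` to the cosimplicial resolution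
`Γ(X)_n = L(rX ⊗ Δ[n])`. -/
def factorizationToCoRes : Factorization γ ⥤ CoRes γ where
  obj P :=
    { Γ := (Factorization.cosimplicial γ).obj P
      isReedyCofibrant := P.isReedyCofibrant
      aug := P.aug
      weakEquivalence_aug := P.weakEquivalence_aug }
  map {P Q} f :=
    { hom := (Factorization.cosimplicial γ).map f
      w := by
        ext X n
        have h := (Factorization.Hom.hom f).naturality (rTensorSimplexProj C X n)
        exact (Category.assoc _ _ _).symm.trans <| (h.symm =≫ _).trans <|
          (Category.assoc _ _ _).trans (_ ≫= Factorization.Hom.w f X) }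
  map_id P := CoRes.Hom.ext ((Factorization.cosimplicial γ).map_id P)
  map_comp f g := CoRes.Hom.ext ((Factorization.cosimplicial γ).map_comp f g)

end FactorizationToCoRes

/-! ### The coend on rX ⊗ Δ[n] and on rX. -/

section TensorRepresentables

variable {C : Type u} [Category.{u} C] {M : Type w} [Category.{u} M] [HasColimits M]
  (Γ : C ⥤ CosimplicialObject M)

/-- The isomorphism `Γ(X)_n ≅ Γ ⊗_𝒞 (rX ⊗ Δ[n])`. -/
def tensorURTensorSimplexIso (X : C) (n : SimplexCategory) :
    (Γ.obj X).obj n ≅ ((tensorU M C).obj Γ).obj (((rTensorSimplex C).obj X).obj n) where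
  hom := tensorUι Γ _ X n (tautSimplex X n)
  inv := tensorUDesc (simplexHom (F := (sing Γ).obj ((Γ.obj X).obj n)) (X := X) (n := n)
    (𝟙 ((Γ.obj X).obj n)))
  hom_inv_id := (tensorUι_desc _ _ _ _).trans (simplexHom_app_tautSimplex _)
  inv_hom_id := by
    -- After transposing, both maps start at rX ⊗ Δ[n], so comparing them on the tautological
    -- simplex is enough.
    apply ((tensorUAdj Γ).homEquiv _ _).injective
    apply rTensorSimplex_hom_ext
    refine (tensorUAdj_homEquiv_app Γ _ X n _).trans
      (Eq.trans ?_ (tensorUAdj_homEquiv_app Γ _ X n _).symm)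
    refine (Category.assoc _ _ _).symm.trans ?_
    refine (((tensorUι_desc _ _ _ _).trans (simplexHom_app_tautSimplex _)) =≫ _).trans ?_
    exact (Category.id_comp _).trans (Category.comp_id _).symm

/-- The map `rX ⟶ ℳ(Γ, W)` attached to a map `Γ(X)_0 ⟶ W`. -/
def rToSing {X : C} {W : M} (g : (Γ.obj X).obj ⦋0⦌ ⟶ W) : (r C).obj X ⟶ (sing Γ).obj W where
  app c :=
    { app := fun n ↦ ↾fun f ↦ (Γ.map (show c.unop ⟶ X from f)).app n.unop ≫
        (Γ.obj X).map (SimplexCategory.const n.unop ⦋0⦌ 0) ≫ g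
      naturality := fun n m φ ↦ by
        ext f
        have h₁ := (Γ.map (show c.unop ⟶ X from f)).naturality φ.unop
        have h₂ : (Γ.obj X).map φ.unop ≫ (Γ.obj X).map (SimplexCategory.const n.unop ⦋0⦌ 0) =
            (Γ.obj X).map (SimplexCategory.const m.unop ⦋0⦌ 0) :=
          ((Γ.obj X).map_comp _ _).symm.trans (congrArg _ (Subsingleton.elim _ _))
        refine (_ ≫= ((h₂ =≫ g).symm.trans (Category.assoc _ _ _))).trans ?_
        exact (Category.assoc _ _ _).symm.trans
          ((h₁.symm =≫ _).trans (Category.assoc _ _ _)) }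
  naturality c d f := by
    ext n g
    have h := NatTrans.congr_app (Γ.map_comp f.unop (show c.unop ⟶ X from g)) n.unop
    exact (h =≫ _).trans (Category.assoc _ _ _)

/-- The isomorphism `Γ(X)_0 ≅ Γ ⊗_𝒞 rX`. -/
def tensorURIso (X : C) : (Γ.obj X).obj ⦋0⦌ ≅ ((tensorU M C).obj Γ).obj ((r C).obj X) where
  hom := tensorUι Γ ((r C).obj X) X ⦋0⦌ (𝟙 X)
  inv := tensorUDesc (rToSing Γ (𝟙 _))
  hom_inv_id := (tensorUι_desc _ _ _ _).trans (by
    change (Γ.map (𝟙 X)).app ⦋0⦌ ≫ (Γ.obj X).map (SimplexCategory.const ⦋0⦌ ⦋0⦌ 0) ≫ 𝟙 _ = 𝟙 _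
    rw [Subsingleton.elim (SimplexCategory.const ⦋0⦌ ⦋0⦌ 0) (𝟙 _)]
    refine (_ ≫= (Category.comp_id _).trans ((Γ.obj X).map_id _)).trans ?_
    exact (Category.comp_id _).trans (NatTrans.congr_app (Γ.map_id X) _))
  inv_hom_id := tensorU_hom_ext fun c n f ↦ by
    refine (Category.assoc _ _ _).symm.trans ((tensorUι_desc _ _ _ _ =≫ _).trans ?_)
    change ((Γ.map (show c ⟶ X from f)).app n ≫
      (Γ.obj X).map (SimplexCategory.const n ⦋0⦌ 0) ≫ 𝟙 _) ≫ _ = _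
    rw [Category.comp_id, Category.comp_id]
    refine (Category.assoc _ _ _).trans ?_
    refine (_ ≫= (tensorUι_map_simplex Γ ((r C).obj X) X (SimplexCategory.const n ⦋0⦌ 0)
      (𝟙 X)).symm).trans ?_
    refine (tensorUι_map_obj Γ ((r C).obj X) (show c ⟶ X from f) n (𝟙 X)).symm.trans ?_
    exact congrArg (tensorUι Γ ((r C).obj X) c n) (Category.comp_id (show c ⟶ X from f))

end TensorRepresentables

/-! ### From cosimplicial resolutions to Quillen factorizations. -/

section CoResToFactorization

variable {C : Type u} [Category.{u} C] {M : Type w} [Category.{u} M] [HasColimits M]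
  [ModelCategory M] {γ : C ⥤ M} (Q : CoRes γ)

lemma CoRes.map_aug (X : C) {n m : SimplexCategory} (φ : n ⟶ m) :
    (Q.Γ.obj X).map φ ≫ (Q.aug.app X).app m = (Q.aug.app X).app n :=
  ((Q.aug.app X).naturality φ).trans (Category.comp_id _)

lemma CoRes.isQuillenPair : IsQuillenPair (tensorUAdj Q.Γ) where
  map_fibration E B p hp X :=
    -- Every degree of Γ(X) maps to γ(X) by a weak equivalence compatible with the cosimplicial
    -- structure, so the structure maps are weak equivalences.
    fibrations_singSSet_map (A := Q.Γ.obj X.unop) (Q.isReedyCofibrant X.unop) (fun n φ ↦ by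
      have h₁ := Q.weakEquivalence_aug X.unop ⦋n⦌
      have h₂ := Q.weakEquivalence_aug X.unop ⦋0⦌
      exact weakEquivalence_of_postcomp_of_fac (Q.map_aug X.unop φ)) p hp
  map_trivialFibration E B p hp := (trivialFibrations_U_iff _).2 fun X ↦
    isReedyCofibrant_iff.1 (Q.isReedyCofibrant X.unop) p hp

/-- The natural transformation `Γ ⊗_𝒞 rX ⟶ γ(X)`. -/
def CoRes.η : r C ⋙ (tensorU M C).obj Q.Γ ⟶ γ where
  app X := (tensorURIso Q.Γ X).inv ≫ (Q.aug.app X).app ⦋0⦌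
  naturality X Y f := by
    have h : (tensorURIso Q.Γ X).hom ≫ ((tensorU M C).obj Q.Γ).map ((r C).map f) =
        (Q.Γ.map f).app ⦋0⦌ ≫ (tensorURIso Q.Γ Y).hom := by
      refine (tensorUι_obj_map Q.Γ ((r C).map f) X ⦋0⦌ (𝟙 X)).trans ?_
      refine Eq.trans ?_ (tensorUι_map_obj Q.Γ ((r C).obj Y) f ⦋0⦌ (𝟙 Y))
      exact congrArg (tensorUι Q.Γ ((r C).obj Y) X ⦋0⦌)
        ((Category.id_comp f).trans (Category.comp_id f).symm)
    have h' := NatTrans.congr_app (Q.aug.naturality f) ⦋0⦌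
    rw [← cancel_epi (tensorURIso Q.Γ X).hom]
    refine (Category.assoc _ _ _).symm.trans ((h =≫ _).trans ?_)
    refine (Category.assoc _ _ _).trans ?_
    rw [Iso.hom_inv_id_assoc, Category.assoc, Iso.hom_inv_id_assoc]
    exact h'

/-- While `η` is defined through the degree 0 part only, this computes it on all the canonical maps,
the form in which `tensorU_hom_ext` compares maps out of the coend. -/
lemma CoRes.tensorUι_η (X c : C) (n : SimplexCategory) (f : c ⟶ X) :
    tensorUι Q.Γ ((r C).obj X) c n f ≫ Q.η.app X =
      (Q.Γ.map f).app n ≫ (Q.aug.app X).app n := by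
  refine (Category.assoc _ _ _).symm.trans ((tensorUι_desc _ _ _ _ =≫ _).trans ?_)
  change ((Q.Γ.map f).app n ≫ (Q.Γ.obj X).map (SimplexCategory.const n ⦋0⦌ 0) ≫ 𝟙 _) ≫ _ = _
  rw [Category.comp_id]
  exact (Category.assoc _ _ _).trans (_ ≫= Q.map_aug X _)

lemma CoRes.weakEquivalence_η (X : C) : WeakEquivalence (Q.η.app X) := by
  have := Q.weakEquivalence_aug X ⦋0⦌
  exact inferInstanceAs (WeakEquivalence ((tensorURIso Q.Γ X).inv ≫ (Q.aug.app X).app ⦋0⦌))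

variable (γ) in
/-- The functor which sends a cosimplicial resolution `Γ` to the factorization given by
`Γ ⊗_𝒞 -` and `ℳ(Γ, -)`. -/
def coResToFactorization : CoRes γ ⥤ Factorization γ where
  obj Q :=
    { L := (tensorU M C).obj Q.Γ
      R := sing Q.Γ
      adj := tensorUAdj Q.Γ
      isQuillenPair := Q.isQuillenPair
      η := Q.η
      weakEquivalence_η := Q.weakEquivalence_η }
  map {Q Q'} f :=
    { hom := (tensorU M C).map (CoRes.Hom.hom f)
      w := fun X ↦ tensorU_hom_ext fun c n x ↦ by
        refine (Category.assoc _ _ _).symm.trans ?_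
        refine (tensorUι_map_app (CoRes.Hom.hom f) ((r C).obj X) c n x =≫ _).trans ?_
        refine (Category.assoc _ _ _).trans ((_ ≫= Q'.tensorUι_η X c n x).trans ?_)
        refine Eq.trans ?_ (Q.tensorUι_η X c n x).symm
        have h₁ := NatTrans.congr_app ((CoRes.Hom.hom f).naturality (show c ⟶ X from x)) n
        have h₂ := NatTrans.congr_app (NatTrans.congr_app (CoRes.Hom.w f) X) n
        exact (Category.assoc _ _ _).symm.trans <| (h₁.symm =≫ _).trans <|
          (Category.assoc _ _ _).trans (_ ≫= h₂) }
  map_id Q := Factorization.Hom.ext ((tensorU M C).map_id Q.Γ)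
  map_comp f g := Factorization.Hom.ext ((tensorU M C).map_comp _ _)

end CoResToFactorization

/-! ### Detecting isomorphisms on underlying natural transformations. -/

section Isomorphisms

variable {C : Type u} [Category.{u} C] {M : Type w} [Category.{u} M] [ModelCategory M] {γ : C ⥤ M}

lemma Factorization.isIso_of_isIso_hom {P Q : Factorization γ} (f : P ⟶ Q)
    [IsIso (Factorization.Hom.hom f)] : IsIso f :=
  ⟨{ hom := inv (Factorization.Hom.hom f)
     w := fun X ↦ by
      rw [← Factorization.Hom.w f X, NatIso.isIso_inv_app, IsIso.inv_hom_id_assoc] },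
    Factorization.Hom.ext (IsIso.hom_inv_id (Factorization.Hom.hom f)),
    Factorization.Hom.ext (IsIso.inv_hom_id (Factorization.Hom.hom f))⟩

lemma CoRes.isIso_of_isIso_hom [HasColimits M] {P Q : CoRes γ} (f : P ⟶ Q)
    [IsIso (CoRes.Hom.hom f)] : IsIso f :=
  ⟨{ hom := inv (CoRes.Hom.hom f)
     w := by rw [← CoRes.Hom.w f, IsIso.inv_hom_id_assoc] },
    CoRes.Hom.ext (IsIso.hom_inv_id (CoRes.Hom.hom f)),
    CoRes.Hom.ext (IsIso.inv_hom_id (CoRes.Hom.hom f))⟩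

end Isomorphisms

/-! ### The two functors are mutually inverse. -/

section Equivalence

variable {C : Type u} [Category.{u} C] {M : Type w} [Category.{u} M] [ModelCategory M]
  [HasColimits M] {γ : C ⥤ M}

/-- The comparison map `Γ(X)_n ⟶ Γ ⊗_𝒞 (rX ⊗ Δ[n])` as a morphism of cosimplicial resolutions. -/
def CoRes.toTensor (Q : CoRes γ) :
    Q ⟶ (factorizationToCoRes γ).obj ((coResToFactorization γ).obj Q) where
  hom :=
    { app := fun X ↦
        { app := fun n ↦ (tensorURTensorSimplexIso Q.Γ X n).hom
          naturality := fun n m φ ↦ by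
            refine (tensorUι_map_simplex Q.Γ _ X φ (tautSimplex X m)).symm.trans ?_
            refine Eq.trans ?_ (tensorUι_obj_map Q.Γ _ X n (tautSimplex X n)).symm
            refine congrArg (tensorUι Q.Γ (((rTensorSimplex C).obj X).obj m) X n) ?_
            exact Prod.ext rfl (SSet.stdSimplex.objEquiv.injective
              ((Category.comp_id φ).trans (Category.id_comp φ).symm)) }
      naturality := fun X Y f ↦ by
        ext n
        refine (tensorUι_map_obj Q.Γ _ f n (tautSimplex Y n)).symm.trans ?_
        refine Eq.trans ?_ (tensorUι_obj_map Q.Γ _ X n (tautSimplex X n)).symm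
        refine congrArg (tensorUι Q.Γ (((rTensorSimplex C).obj Y).obj n) X n) ?_
        exact Prod.ext ((Category.comp_id f).trans (Category.id_comp f).symm) rfl }
  w := by
    ext X n
    refine (Category.assoc _ _ _).symm.trans ?_
    refine (tensorUι_obj_map Q.Γ (rTensorSimplexProj C X n) X n (tautSimplex X n) =≫ _).trans ?_
    refine (Q.tensorUι_η X X n (𝟙 X)).trans ?_
    exact (NatTrans.congr_app (Q.Γ.map_id X) n =≫ _).trans (Category.id_comp _)

lemma CoRes.isIso_toTensor (Q : CoRes γ) : IsIso Q.toTensor := by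
  have (X : C) (n : SimplexCategory) : IsIso (((CoRes.Hom.hom Q.toTensor).app X).app n) :=
    inferInstanceAs (IsIso (tensorURTensorSimplexIso Q.Γ X n).hom)
  have (X : C) : IsIso ((CoRes.Hom.hom Q.toTensor).app X) := NatIso.isIso_of_isIso_app _
  have : IsIso (CoRes.Hom.hom Q.toTensor) := NatIso.isIso_of_isIso_app _
  exact CoRes.isIso_of_isIso_hom _

variable (γ) in
/-- The natural isomorphism `Γ(X)_n ≅ Γ ⊗_𝒞 (rX ⊗ Δ[n])`. -/
def coResIso : 𝟭 (CoRes γ) ≅ coResToFactorization γ ⋙ factorizationToCoRes γ :=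
  NatIso.ofComponents (fun Q ↦ @asIso _ _ _ _ Q.toTensor Q.isIso_toTensor)
    (fun {Q Q'} f ↦ CoRes.Hom.ext (by
    ext X n
    exact (tensorUι_map_app (CoRes.Hom.hom f) _ X n (tautSimplex X n)).symm))

namespace Factorization

variable (P : Factorization γ)

/-- The comparison map `Γ ⊗_𝒞 F ⟶ L(F)` where `Γ(X)_n = L(rX ⊗ Δ[n])`. -/
def tensorDesc (F : U C) :
    ((tensorU M C).obj ((Factorization.cosimplicial γ).obj P)).obj F ⟶ P.L.obj F :=
  tensorUDesc (P.adj.unit.app F ≫ P.singIso.hom.app (P.L.obj F))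

/-- The transpose of L(`simplexHom x`) is the unit applied to the simplex `x`, by naturality of the
unit. -/
lemma tensorUι_tensorDesc (F : U C) (c : C) (n : SimplexCategory)
    (x : (F.obj (op c)).obj (op n)) :
    tensorUι ((Factorization.cosimplicial γ).obj P) F c n x ≫ P.tensorDesc F =
      P.L.map (simplexHom x) := by
  refine (tensorUι_desc _ c n x).trans ?_
  refine (P.singIso_hom_app_app_app _ c n _).trans ?_
  refine (Equiv.symm_apply_eq _).2 ?_
  exact (simplexHom_comp x (P.adj.unit.app F)).symm.trans <|
    (P.adj.unit_naturality (simplexHom x)).symm.trans (P.adj.homEquiv_unit _ _ _).symm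

/-- This says that `tensorDesc` is the mate of `singIso`; invertibility of the latter can thus be
transferred to the former. -/
lemma homEquiv_tensorDesc_comp {F : U C} {W : M} (g : P.L.obj F ⟶ W) :
    (tensorUAdj _).homEquiv F W (P.tensorDesc F ≫ g) =
      P.adj.homEquiv F W g ≫ P.singIso.hom.app W := by
  ext ⟨c⟩ ⟨n⟩ x
  refine (tensorUAdj_homEquiv_app _ _ c n x).trans ?_
  refine (Category.assoc _ _ _).symm.trans ((P.tensorUι_tensorDesc F c n x =≫ g).trans ?_)
  refine Eq.trans ?_ (P.singIso_hom_app_app_app W c n _).symm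
  refine (Equiv.eq_symm_apply _).2 ?_
  exact (P.adj.homEquiv_naturality_left _ _).trans (simplexHom_comp x _)

/-- By Yoneda it suffices that precomposition is bijective on maps to every W; through the two
adjunctions it becomes postcomposition with the isomorphism `singIso`. -/
lemma isIso_tensorDesc (F : U C) : IsIso (P.tensorDesc F) := by
  rw [isIso_iff_coyoneda_map_bijective]
  intro W
  have h : Function.Bijective (fun g : P.L.obj F ⟶ W ↦
      (tensorUAdj _).homEquiv F W (P.tensorDesc F ≫ g)) := by
    simp only [homEquiv_tensorDesc_comp]
    exact (((P.adj.homEquiv F W).trans ((P.singIso.app W).homToEquiv (Z := F)))).bijective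
  exact (Function.Bijective.of_comp_iff' ((tensorUAdj _).homEquiv F W).bijective _).1 h

/-- The comparison map `Γ ⊗_𝒞 F ⟶ L(F)` as a morphism of factorizations. -/
def fromTensor : (coResToFactorization γ).obj ((factorizationToCoRes γ).obj P) ⟶ P where
  hom :=
    { app := P.tensorDesc
      naturality := fun F G f ↦ tensorU_hom_ext fun c n x ↦ by
        refine (Category.assoc _ _ _).symm.trans ((tensorUι_obj_map _ f c n x =≫ _).trans ?_)
        refine (P.tensorUι_tensorDesc G c n _).trans ?_
        refine Eq.trans ?_ ((P.tensorUι_tensorDesc F c n x).symm =≫ P.L.map f |>.trans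
          (Category.assoc _ _ _))
        rw [← P.L.map_comp, simplexHom_comp] }
  w X := tensorU_hom_ext fun c n x ↦ by
    refine (Category.assoc _ _ _).symm.trans ((P.tensorUι_tensorDesc _ c n x =≫ _).trans ?_)
    refine Eq.trans ?_ (((factorizationToCoRes γ).obj P).tensorUι_η X c n x).symm
    have h := (rTensorSimplexProj_naturality_obj (show c ⟶ X from x) n).trans
      (rTensorSimplexProj_eq_simplexHom (show c ⟶ X from x) n)
    exact (((congrArg P.L.map h.symm).trans (P.L.map_comp _ _)) =≫ _).trans (Category.assoc _ _ _)

lemma isIso_fromTensor : IsIso P.fromTensor := by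
  have (F : U C) : IsIso ((Factorization.Hom.hom P.fromTensor).app F) :=
    P.isIso_tensorDesc F
  have : IsIso (Factorization.Hom.hom P.fromTensor) := NatIso.isIso_of_isIso_app _
  exact Factorization.isIso_of_isIso_hom _

end Factorization

variable (γ) in
/-- The natural isomorphism `Γ ⊗_𝒞 F ≅ L(F)` where `Γ(X)_n = L(rX ⊗ Δ[n])`. -/
def factorizationIso : factorizationToCoRes γ ⋙ coResToFactorization γ ≅ 𝟭 (Factorization γ) :=
  NatIso.ofComponents (fun P ↦ @asIso _ _ _ _ P.fromTensor P.isIso_fromTensor)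
    (fun {P Q} f ↦ Factorization.Hom.ext (by
    ext F
    refine tensorU_hom_ext fun c n x ↦ ?_
    refine (Category.assoc _ _ _).symm.trans ((tensorUι_map_app _ F c n x =≫ _).trans ?_)
    refine (Category.assoc _ _ _).trans ((_ ≫= Q.tensorUι_tensorDesc F c n x).trans ?_)
    refine Eq.trans ?_ ((P.tensorUι_tensorDesc F c n x).symm =≫ _ |>.trans (Category.assoc _ _ _))
    exact ((Factorization.Hom.hom f).naturality (simplexHom x)).symm))

variable (γ) in
/-- The equivalence between factorizations and cosimplicial resolutions. -/
def factorizationEquivalence : Factorization γ ≌ CoRes γ :=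
  -- `Equivalence.mk` adjusts only the unit, to obtain the triangle identity; both functors stay as
  -- given.
  CategoryTheory.Equivalence.mk (factorizationToCoRes γ) (coResToFactorization γ)
    (factorizationIso γ).symm (coResIso γ).symm

end Equivalence

end

end UniversalModelCategory

open UniversalModelCategory in
theorem proposition3p4 {C : Type u} [Category.{u} C] {M : Type w} [Category.{u} M]
    [ModelCategory M] [HasColimits M] (γ : C ⥤ M) :
    ∃ (E : Factorization γ ≌ CoRes γ)
      (e₁ : E.functor ⋙ CoRes.forget γ ≅ Factorization.cosimplicial γ)
      (e₂ : E.inverse ⋙ Factorization.left γ ≅ CoRes.forget γ ⋙ tensorU M C)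
      (e₃ : ∀ Q : CoRes γ, (E.inverse.obj Q).R ≅ sing Q.Γ),
      (∀ (P : Factorization γ) (X : C) (n : SimplexCategory),
        ((E.functor.obj P).aug.app X).app n =
          ((e₁.hom.app P).app X).app n ≫
            P.L.map (rTensorSimplexProj C X n) ≫ P.η.app X) ∧
      (∀ (Q : CoRes γ) (X : C),
        IsIso (tensorUι Q.Γ ((r C).obj X) X ⦋0⦌ (𝟙 X)) ∧
        tensorUι Q.Γ ((r C).obj X) X ⦋0⦌ (𝟙 X) ≫
          (e₂.inv.app Q).app ((r C).obj X) ≫ (E.inverse.obj Q).η.app X =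
            (Q.aug.app X).app ⦋0⦌) ∧
      (∀ (Q : CoRes γ) (F : U C) (W : M) (f : (E.inverse.obj Q).L.obj F ⟶ W)
        (c : C) (n : SimplexCategory) (x : (F.obj (op c)).obj (op n)),
        ((((E.inverse.obj Q).adj.homEquiv F W f) ≫ (e₃ Q).hom.app W).app (op c)).app (op n) x =
          tensorUι Q.Γ F c n x ≫ (e₂.inv.app Q).app F ≫ f) := by
  -- Both functors were built from the required formulas, so all three comparison isomorphisms are
  -- identities.
  refine ⟨factorizationEquivalence γ, NatIso.ofComponents (fun _ ↦ Iso.refl _) ?_,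
    NatIso.ofComponents (fun _ ↦ Iso.refl _) ?_, fun _ ↦ Iso.refl _, ?_, ?_, ?_⟩
  · intro P Q f
    exact (Category.comp_id _).trans (Category.id_comp _).symm
  · intro P Q f
    exact (Category.comp_id _).trans (Category.id_comp _).symm
  · intro P X n
    exact (Category.id_comp _).symm
  · intro Q X
    refine ⟨inferInstanceAs (IsIso (tensorURIso Q.Γ X).hom), ?_⟩
    refine (_ ≫= Category.id_comp _).trans ?_
    exact Iso.hom_inv_id_assoc (tensorURIso Q.Γ X) _
  · intro Q F W f c n x
    refine Eq.trans ?_ (_ ≫= (Category.id_comp f).symm)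
    exact tensorUAdj_homEquiv_app Q.Γ f c n x
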